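/- **Notation.** Partitions are identified with their diagrams; a cell has coordinates $(i,j)$, where $i\ge 0$ is its row and $j\ge 0$ its column. Put $T_\nu=\prod_{(i,j)\in\nu}t^iq^j$ and $n(\nu)=\sum_{(i,j)\in\nu}i$. Symmetric functions have coefficients in $\mathbb Q(q,t)$; $f[E]$ denotes plethystic substitution, which replaces each power sum $p_r$ by $p_r[E]$, obtained from $E$ by raising all its variables to the $r$-th power (so $p_r[\frac X{1-t}]=\frac{p_r}{1-t^r}$, and $e_k[\frac1{T_1}+\cdots+\frac1{T_m}-\frac1{T_i}]$ is the $k$-th elementary symmetric function of the $1/T_j$, $j\ne i$). Let $\{P_\nu(x;q,t)\}$ be the Macdonald polynomials (unitriangular in the Schur functions $S_\nu$ for dominance order, and orthogonal for $\langle p_\lambda,p_\lambda\rangle_{q,t}=z_\lambda\, p_\lambda[\frac{1-q}{1-t}]$, $\langle p_\lambda,p_\rho\rangle_{q,t}=0$ for $\lambda\ne\rho$), let $J_\nu=\prod_{s\in\nu}(1-q^{a(s)}t^{l(s)+1})P_\nu$ with $a(s),l(s)$ the arm and leg of $s$, $H_\nu(x;q,t)=J_\nu[\frac{X}{1-t};q,t]$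 and $\widetilde H_\nu(x;q,t)=t^{n(\nu)}H_\nu(x;q,1/t)$. Let $\nabla$ be the linear operator with $\nabla\widetilde H_\nu=T_\nu\widetilde H_\nu$ for all $\nu$. For $\nu\vdash n$ let $\Delta_\nu=\det\|x_r^{i_s}y_r^{j_s}\|_{r,s=1}^n$, where $(i_1,j_1),\dots,(i_n,j_n)$ are the cells of $\nu$ in lexicographic order, let $\mathbf M_\nu\subset\mathbb Q[x_1,\dots,x_n;y_1,\dots,y_n]$ be the span of all partial derivatives of $\Delta_\nu$, and let $\mathbf{flip}_\nu P=P(\partial)\Delta_\nu$. The group $S_n$ acts diagonally. For an $S_n$-invariant subspace $V$ of $\mathbf M_\nu$ (or of a sum of such spaces) that is spanned by bihomogeneous elements, $\mathcal F(V)=\frac1{n!}\sum_{\sigma\in S_n}\sum_{h,k}t^hq^k\,\mathrm{tr}(\sigma|V_{h,k})\,p_{\lambda(\sigma)}$, where $V_{h,k}$ is the part of degree $h$ in $x$ and $k$ in $y$, and $\lambda(\sigma)$ is the cycle type of $\sigma$. **Setting.** Let $\mu\vdash n+1$ have $m$ corners, let $\alpha^{(1)},\dots,\alpha^{(m)}\vdash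 n$ be the partitions obtained from $\mu$ by removing one corner, and write $T_i=T_{\alpha^{(i)}}$. Assume that $\mathcal F(\mathbf M_{\alpha^{(i)}})=\widetilde H_{\alpha^{(i)}}$ for all $i$, and that $\mathcal B$ is a basis of $\sum_i\mathbf M_{\alpha^{(i)}}$ consisting of bihomogeneous polynomials, with subsets $\mathcal B_1,\dots,\mathcal B_m\subseteq\mathcal B$, as in the Science Fiction (SF) heuristic: 1. $\mathcal B_i$ spans $\mathbf M_{\alpha^{(i)}}$ for each $i$; 2. for every $S\subseteq\{1,\dots,m\}$ the span $\mathbf M^{=S}$ of $\{b\in\mathcal B: b\in\mathcal B_i\Leftrightarrow i\in S\text{ for all }i\}$ is $S_n$-invariant; 3. if $i\in S$, then $\mathbf{flip}_{\alpha^{(i)}}\mathbf M^{=S}\cong\mathbf M^{=S'}$ as bigraded $S_n$-modules, where $S'=\{i\}\cup(\{1,\dots,m\}\setminus S)$. Let $$\Phi_\mu=\sum_{j=1}^m\Bigl(\prod_{s\ne j}\frac1{1-T_j/T_s}\Bigr)\widetilde H_{\alpha^{(j)}},\qquad \Phi^{=S}=\mathcal F(\mathbf M^{=S}),\qquad \Phi^{\supseteq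 S}=\mathcal F\Bigl(\bigcap_{i\in S}\mathbf M_{\alpha^{(i)}}\Bigr)\quad(S\ne\emptyset).$$ **Theorem.** There are symmetric functions $\Phi^{(1)},\dots,\Phi^{(m)}$ such that $\Phi^{=S}=\Phi^{(k)}/\prod_{i\notin S}T_i$ for all nonempty $S\subseteq\{1,\dots,m\}$, where $k=|S|$ (this determines them), and they satisfy the following. * For $k=1,\dots,m$: $\Phi^{(k)}=(-\nabla)^{m-k}\Phi_\mu$. * For every nonempty $S\subseteq\{1,\dots,m\}$: $\Phi^{\supseteq S}=\prod_{i\notin S}\bigl(1-\nabla/T_i\bigr)\Phi_\mu$. * For $i=1,\dots,m$: $$\widetilde H_{\alpha^{(i)}}=\prod_{s\ne i}\bigl(1-\nabla/T_s\bigr)\Phi_\mu=\sum_{k=1}^m\Phi^{(k)}\,e_{m-k}\Bigl[\tfrac1{T_1}+\cdots+\tfrac1{T_m}-\tfrac1{T_i}\Bigr].$$ * $\Phi^{(1)},\dots,\Phi^{(m)}$ form a basis of the $\mathbb Q(q,t)$-span of $\widetilde H_{\alpha^{(1)}},\dots,\widetilde H_{\alpha^{(m)}}$. * For $k=1,\dots,m$: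 $$\Phi^{(k)}=\sum_{j=1}^m\Bigl(\prod_{s\ne j}\frac1{1-T_j/T_s}\Bigr)(-T_j)^{m-k}\,\widetilde H_{\alpha^{(j)}}.$$ -/

import Mathlib

noncomputable section

namespace ScienceFiction

open MvPolynomial

/-! ## Symmetric functions

Over a field `K` of characteristic zero the ring of symmetric functions is the polynomial ring
`K[p₁, p₂, …]` in the power sums. A `λ`-ring substitution is an algebra homomorphism given by its
values on the power sums. -/

/-- Symmetric functions with coefficients in `K`; the variable `X r` is the power sum `p_r`. -/
abbrev SymFun (K : Type*) [Field K] : Type _ := MvPolynomial ℕ+ K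

section SymmetricFunctions

variable (K : Type*) [Field K]

/-- The power sum `p_r` (only used for `r ≥ 1`). -/
def powerSum (r : ℕ) : SymFun K := X r.toPNat'

/-- The complete homogeneous symmetric functions:
`(n+1) h_{n+1} = ∑_{r=1}^{n+1} p_r h_{n+1-r}`. -/
def complete : ℕ → SymFun K
  | 0 => 1
  | n + 1 => C ((n + 1 : K)⁻¹) * ∑ r : Fin (n + 1), powerSum K (r + 1) * complete (n - r)
termination_by n => n
decreasing_by omega

/-- The elementary symmetric functions:
`(n+1) e_{n+1} = ∑_{r=1}^{n+1} (-1)^{r-1} p_r e_{n+1-r}`. -/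
def elementary : ℕ → SymFun K
  | 0 => 1
  | n + 1 => C ((n + 1 : K)⁻¹) *
      ∑ r : Fin (n + 1), (-1) ^ (r : ℕ) * powerSum K (r + 1) * elementary (n - r)
termination_by n => n
decreasing_by omega

/-- The Schur function `S_ν = det (h_{ν_i - i + j})` (Jacobi–Trudi), `i, j` ranging over the
rows of `ν`, with `h_r = 0` for `r < 0`. -/
def schur (ν : YoungDiagram) : SymFun K :=
  (Matrix.of fun i j : Fin (ν.colLen 0) =>
    if (i : ℕ) ≤ ν.rowLen i + j then complete K (ν.rowLen i + j - i) else 0).det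

variable {K}

/-- The `q,t`-scalar product: the power sum products
`p_s = ∏_r p_r^{s_r}` are orthogonal and `⟨p_s, p_s⟩ = z_s p_s[(1-q)/(1-t)]`, where
`z_s = ∏_r r^{s_r} s_r!`. -/
def qtInner (q t : K) (f g : SymFun K) : K :=
  ∑ s ∈ f.support, f.coeff s * g.coeff s *
    ∏ r ∈ s.support, ((r : ℕ) : K) ^ s r * ((s r).factorial : K) *
      ((1 - q ^ (r : ℕ)) / (1 - t ^ (r : ℕ))) ^ s r

/-- The substitution `f ↦ f[X/(1-t)]`, that is `p_r ↦ p_r/(1-t^r)`. -/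
def plethysmDiv (t : K) : SymFun K →ₐ[K] SymFun K :=
  aeval fun r : ℕ+ => C ((1 - t ^ (r : ℕ))⁻¹) * X r

/-- The value `f[E]` at an expression `E`, given through the power sums `E r = p_r[E]`. -/
def plethysmEval (E : ℕ → K) : SymFun K →ₐ[K] K :=
  aeval fun r : ℕ+ => E r

end SymmetricFunctions

/-! ## The dominance order -/

/-- `ν` is strictly smaller than `lam` in the dominance order. -/
def StrictDom (ν lam : YoungDiagram) : Prop :=
  ν.card = lam.card ∧
    (∀ k, ∑ i ∈ Finset.range k, ν.rowLen i ≤ ∑ i ∈ Finset.range k, lam.rowLen i) ∧ ν ≠ lam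

theorem cells_subset_of_card (ν : YoungDiagram) :
    ν.cells ⊆ Finset.range ν.card ×ˢ Finset.range ν.card := by
  rintro ⟨i, j⟩ h
  rw [YoungDiagram.mem_cells] at h
  have h1 : i < ν.colLen j := YoungDiagram.mem_iff_lt_colLen.1 h
  have h2 : j < ν.rowLen i := YoungDiagram.mem_iff_lt_rowLen.1 h
  have h3 : ν.colLen j ≤ ν.card := by
    rw [YoungDiagram.colLen_eq_card]; exact Finset.card_le_card (Finset.filter_subset _ _)
  have h4 : ν.rowLen i ≤ ν.card := by
    rw [YoungDiagram.rowLen_eq_card]; exact Finset.card_le_card (Finset.filter_subset _ _)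
  simp only [Finset.mem_product, Finset.mem_range]
  omega

theorem finite_strictDom (lam : YoungDiagram) : {ν | StrictDom ν lam}.Finite := by
  apply Set.Finite.of_finite_image (f := YoungDiagram.cells)
  · apply (Finset.finite_toSet
      (Finset.range lam.card ×ˢ Finset.range lam.card).powerset).subset
    rintro _ ⟨ν, hν, rfl⟩
    have := cells_subset_of_card ν
    rw [hν.1] at this
    exact Finset.mem_coe.2 (Finset.mem_powerset.2 this)
  · intro a _ b _ h
    exact YoungDiagram.ext h

/-- The finite set of diagrams strictly dominated by `lam`. -/
def dominated (lam : YoungDiagram) : Finset YoungDiagram := (finite_strictDom lam).toFinset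

theorem mem_dominated {ν lam : YoungDiagram} : ν ∈ dominated lam ↔ StrictDom ν lam := by
  simp [dominated]

theorem strictDom_antisymm {ν lam : YoungDiagram} (h : StrictDom ν lam) : ¬ StrictDom lam ν := by
  intro h'
  apply h.2.2
  have hs : ∀ k, ∑ i ∈ Finset.range k, ν.rowLen i = ∑ i ∈ Finset.range k, lam.rowLen i :=
    fun k => le_antisymm (h.2.1 k) (h'.2.1 k)
  have hr : ∀ k, ν.rowLen k = lam.rowLen k := by
    intro k
    have h1 := hs (k + 1)
    rw [Finset.sum_range_succ, Finset.sum_range_succ, hs k] at h1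
    omega
  ext ⟨i, j⟩
  rw [YoungDiagram.mem_cells, YoungDiagram.mem_cells, YoungDiagram.mem_iff_lt_rowLen,
    YoungDiagram.mem_iff_lt_rowLen, hr]

theorem card_dominated_lt {ν lam : YoungDiagram} (h : StrictDom ν lam) :
    (dominated ν).card < (dominated lam).card := by
  apply Finset.card_lt_card
  refine ⟨fun κ hκ => ?_, fun hsub => ?_⟩
  · rw [mem_dominated] at hκ ⊢
    refine ⟨hκ.1.trans h.1, fun k => (hκ.2.1 k).trans (h.2.1 k), ?_⟩
    rintro rfl
    exact strictDom_antisymm h hκ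
  · exact (mem_dominated.1 (hsub (mem_dominated.2 h))).2.2 rfl

/-! ## Macdonald polynomials -/

section Macdonald

variable {K : Type*} [Field K]

/-- The Macdonald polynomial `P_lam(x;q,t)`: the family that is unitriangular with respect to the
Schur functions in the dominance order and orthogonal for the `q,t`-scalar product. It is obtained
from the Schur functions by the Gram–Schmidt process: the coefficient of `P_ν` in the expansion
`S_lam = P_lam + ∑_{ν < lam} c_ν P_ν` is `c_ν = ⟨S_lam, P_ν⟩ / ⟨P_ν, P_ν⟩` by orthogonality. -/
def macdonaldP (q t : K) (lam : YoungDiagram) : SymFun K :=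
  schur K lam - ∑ ν ∈ (dominated lam).attach,
    (qtInner q t (schur K lam) (macdonaldP q t ν.1) /
      qtInner q t (macdonaldP q t ν.1) (macdonaldP q t ν.1)) • macdonaldP q t ν.1
termination_by (dominated lam).card
decreasing_by all_goals exact card_dominated_lt (mem_dominated.1 ν.2)

/-- The number of cells strictly east of the cell `s` of `ν`. -/
def arm (ν : YoungDiagram) (s : ℕ × ℕ) : ℕ := ν.rowLen s.1 - s.2 - 1

/-- The number of cells strictly north (French convention) of the cell `s` of `ν`. -/
def leg (ν : YoungDiagram) (s : ℕ × ℕ) : ℕ := ν.colLen s.2 - s.1 - 1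

/-- The integral form `J_ν(x;q,t) = ∏_{s ∈ ν} (1 - q^{a(s)} t^{l(s)+1}) P_ν(x;q,t)`. -/
def macdonaldJ (q t : K) (ν : YoungDiagram) : SymFun K :=
  (∏ s ∈ ν.cells, (1 - q ^ arm ν s * t ^ (leg ν s + 1))) • macdonaldP q t ν

/-- `H_ν(x;q,t) = J_ν[X/(1-t);q,t]`. -/
def macdonaldH (q t : K) (ν : YoungDiagram) : SymFun K :=
  plethysmDiv t (macdonaldJ q t ν)

/-- The modified Macdonald polynomial `H̃_ν(x;q,t) = t^{n(ν)} H_ν(x;q,1/t)`, where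
`n(ν) = ∑_{(i,j) ∈ ν} i` (rows numbered from `0`). -/
def modifiedH (q t : K) (ν : YoungDiagram) : SymFun K :=
  t ^ (∑ s ∈ ν.cells, s.1) • macdonaldH q t⁻¹ ν

end Macdonald

/-! ## Specialization to `ℚ(q,t)` -/

/-- The field `ℚ(q,t)`. -/
abbrev Qqt : Type := FractionRing (MvPolynomial (Fin 2) ℚ)

/-- The indeterminate `q`. -/
def qvar : Qqt := algebraMap (MvPolynomial (Fin 2) ℚ) Qqt (X 0)

/-- The indeterminate `t`. -/
def tvar : Qqt := algebraMap (MvPolynomial (Fin 2) ℚ) Qqt (X 1)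

/-- `T_ν = ∏_{(i,j) ∈ ν} t^i q^j` (rows and columns numbered from `0`). -/
def Tmon (ν : YoungDiagram) : Qqt := ∏ s ∈ ν.cells, tvar ^ s.1 * qvar ^ s.2

/-- `H̃_ν(x;q,t)` over `ℚ(q,t)`. -/
def Htilde (ν : YoungDiagram) : SymFun Qqt := modifiedH qvar tvar ν

open Classical in
/-- The operator `∇`: the linear operator on symmetric functions with `∇ H̃_ν = T_ν H̃_ν` for every
partition `ν`. As the `H̃_ν` form a basis, it exists and is unique. -/
def nabla : Module.End Qqt (SymFun Qqt) :=
  if h : ∃ L : Module.End Qqt (SymFun Qqt), ∀ ν, L (Htilde ν) = Tmon ν • Htilde ν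
  then h.choose else 0

/-! ## The modules `M_ν` -/

/-- Polynomials over `ℚ` in `x_1, …, x_n` (the variables `Sum.inl i`) and `y_1, …, y_n` (the
variables `Sum.inr i`). -/
abbrev PolyXY (n : ℕ) : Type := MvPolynomial (Fin n ⊕ Fin n) ℚ

/-- The bidegree weight: `x_i` has bidegree `(1,0)` and `y_i` has bidegree `(0,1)`. -/
def bideg (n : ℕ) : Fin n ⊕ Fin n → ℕ × ℕ := Sum.elim (fun _ => (1, 0)) (fun _ => (0, 1))

/-- The diagonal action of a permutation: `x_i ↦ x_{σ i}`, `y_i ↦ y_{σ i}`. -/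
def diagAct {n : ℕ} (σ : Equiv.Perm (Fin n)) : PolyXY n →ₗ[ℚ] PolyXY n :=
  (rename (Sum.map σ σ) : PolyXY n →ₐ[ℚ] PolyXY n).toLinearMap

/-- The partial derivative with respect to the variable `v`, as a linear operator. -/
def partialD {n : ℕ} (v : Fin n ⊕ Fin n) : Module.End ℚ (PolyXY n) :=
  (pderiv v : Derivation ℚ (PolyXY n) (PolyXY n)).toLinearMap

theorem partialD_commute {n : ℕ} (v w : Fin n ⊕ Fin n) :
    Commute (partialD v) (partialD w) := by
  have h : ⁅(pderiv v : Derivation ℚ (PolyXY n) (PolyXY n)),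
      (pderiv w : Derivation ℚ (PolyXY n) (PolyXY n))⁆ = 0 := by
    apply MvPolynomial.derivation_ext (R := ℚ)
    intro u
    rw [Derivation.commutator_apply]
    have hc : ∀ a b : Fin n ⊕ Fin n, (pderiv a (pderiv b (X u : PolyXY n)) : PolyXY n) = 0 := by
      intro a b
      by_cases hb : u = b
      · subst hb; simp
      · rw [pderiv_X_of_ne hb, map_zero]
    rw [hc, hc, sub_zero, Derivation.zero_apply]
  refine LinearMap.ext fun f => ?_
  have := congrArg (fun D : Derivation ℚ (PolyXY n) (PolyXY n) => D f) h
  simp only [Derivation.commutator_apply, Derivation.zero_apply, sub_eq_zero] at this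
  exact this

/-- The higher partial derivative `∏_v ∂_v^{s_v}`. -/
def partialDs {n : ℕ} (s : Fin n ⊕ Fin n →₀ ℕ) : Module.End ℚ (PolyXY n) :=
  Finset.univ.noncommProd (fun v => partialD v ^ s v)
    fun v _ w _ _ => (partialD_commute v w).pow_pow _ _

/-- The determinant `Δ_ν = det ‖x_i^{p_j} y_i^{q_j}‖`, where `(p_1,q_1), …, (p_n,q_n)` are the
cells of `ν` (rows and columns numbered from `0`) in lexicographic order. -/
def Delta {n : ℕ} (ν : YoungDiagram) (hν : ν.card = n) : PolyXY n :=
  let e : Fin n ↪o ℕ ×ₗ ℕ :=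
    (ν.cells.map toLex.toEmbedding).orderEmbOfFin ((Finset.card_map _).trans hν)
  (Matrix.of fun i j : Fin n =>
    (X (Sum.inl i) ^ (ofLex (e j)).1 * X (Sum.inr i) ^ (ofLex (e j)).2 : PolyXY n)).det

/-- `M_ν`, the linear span of all the partial derivatives of `Δ_ν`. -/
def GHModule {n : ℕ} (ν : YoungDiagram) (hν : ν.card = n) : Submodule ℚ (PolyXY n) :=
  Submodule.span ℚ (Set.range fun s : Fin n ⊕ Fin n →₀ ℕ => partialDs s (Delta ν hν))

/-- The map `P ↦ P(∂) Δ_ν`, which is the `flip` operation on `M_ν`. -/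
def flip {n : ℕ} (ν : YoungDiagram) (hν : ν.card = n) : PolyXY n →ₗ[ℚ] PolyXY n :=
  (basisMonomials (Fin n ⊕ Fin n) ℚ).constr ℚ fun s => partialDs s (Delta ν hν)

/-- Isomorphism of bigraded `S_n`-modules, for `S_n`-invariant subspaces of `ℚ[x,y]` spanned by
bihomogeneous elements. -/
def BigradedIso {n : ℕ} (V W : Submodule ℚ (PolyXY n)) : Prop :=
  ∃ e : V ≃ₗ[ℚ] W,
    (∀ (σ : Equiv.Perm (Fin n)) (P P' : V), (P' : PolyXY n) = diagAct σ P →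
      (e P' : PolyXY n) = diagAct σ (e P)) ∧
    ∀ (d : ℕ × ℕ) (P : V), IsWeightedHomogeneous (bideg n) (P : PolyXY n) d →
      IsWeightedHomogeneous (bideg n) (e P : PolyXY n) d

open Classical in
/-- The trace of the restriction of `f` to an `f`-invariant subspace `V`. -/
def traceOn {E : Type*} [AddCommGroup E] [Module ℚ E] (f : E →ₗ[ℚ] E) (V : Submodule ℚ E) : ℚ :=
  if h : ∀ v ∈ V, f v ∈ V then LinearMap.trace ℚ V (f.restrict h) else 0

/-- The bigraded character `∑_{h,k} t^h q^k char H_{h,k}(V)` at `σ`, where `H_{h,k}(V)` consists of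
the elements of `V` that are bihomogeneous of degree `h` in `x` and `k` in `y`. -/
def bigradedChar {n : ℕ} (V : Submodule ℚ (PolyXY n)) (σ : Equiv.Perm (Fin n)) : Qqt :=
  ∑ᶠ d : ℕ × ℕ, tvar ^ d.1 * qvar ^ d.2 *
    algebraMap ℚ Qqt (traceOn (diagAct σ) (V ⊓ weightedHomogeneousSubmodule ℚ (bideg n) d))

/-- The bivariate Frobenius characteristic
`F(V) = (1/n!) ∑_{σ ∈ S_n} χ^V(σ;q,t) p_{λ(σ)}`, with `λ(σ)` the cycle type of `σ`
(fixed points included). -/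
def frobenius {n : ℕ} (V : Submodule ℚ (PolyXY n)) : SymFun Qqt :=
  (n.factorial : Qqt)⁻¹ • ∑ σ : Equiv.Perm (Fin n),
    bigradedChar V σ • (σ.partition.parts.map (powerSum Qqt)).prod

/-! ## Corners and predecessors of a partition -/

/-- The corner cells of `μ`: those with no cell of `μ` directly above or directly to the right. -/
def corners (μ : YoungDiagram) : Finset (ℕ × ℕ) :=
  μ.cells.filter fun c => (c.1 + 1, c.2) ∉ μ.cells ∧ (c.1, c.2 + 1) ∉ μ.cells

/-- The type of corners of `μ`; it indexes the predecessors of `μ`. -/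
abbrev Corner (μ : YoungDiagram) : Type := {c : ℕ × ℕ // c ∈ corners μ}

/-- The predecessor of `μ` obtained by removing the corner `c`. -/
def pred (μ : YoungDiagram) (c : Corner μ) : YoungDiagram where
  cells := μ.cells.erase c
  isLowerSet := by
    obtain ⟨⟨i, j⟩, hc⟩ := c
    simp only [corners, Finset.mem_filter] at hc
    rintro ⟨a, b⟩ ⟨a', b'⟩ hle hab
    simp only [Finset.coe_erase, Set.mem_sdiff, Finset.mem_coe, Set.mem_singleton_iff,
      Prod.mk.injEq] at hab ⊢
    obtain ⟨h1, h2⟩ := Prod.mk_le_mk.1 hle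
    refine ⟨μ.up_left_mem h1 h2 hab.1, ?_⟩
    rintro ⟨rfl, rfl⟩
    rcases Nat.eq_or_lt_of_le h1 with h | h
    · subst h
      rcases Nat.eq_or_lt_of_le h2 with h' | h'
      · exact hab.2 ⟨rfl, h'.symm⟩
      · exact hc.2.2 (μ.up_left_mem le_rfl h' hab.1)
    · exact hc.2.1 (μ.up_left_mem h h2 hab.1)

theorem card_pred {n : ℕ} {μ : YoungDiagram} (hμ : μ.card = n + 1) (c : Corner μ) :
    (pred μ c).card = n := by
  have hc : (c : ℕ × ℕ) ∈ μ.cells := (Finset.mem_filter.1 c.2).1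
  have h : (pred μ c).card = μ.cells.card - 1 := Finset.card_erase_of_mem hc
  have h' : μ.cells.card = n + 1 := hμ
  omega

/-- `T_c`, the monomial `T` of the predecessor of `μ` at the corner `c`. -/
def Tc {μ : YoungDiagram} (c : Corner μ) : Qqt := Tmon (pred μ c)

/-- `H̃` of the predecessor of `μ` at the corner `c`. -/
def Hc {μ : YoungDiagram} (c : Corner μ) : SymFun Qqt := Htilde (pred μ c)

/-- The module `M` of the predecessor of `μ` at the corner `c`. -/
def Mc {n : ℕ} {μ : YoungDiagram} (hμ : μ.card = n + 1) (c : Corner μ) :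
    Submodule ℚ (PolyXY n) := GHModule (pred μ c) (card_pred hμ c)

/-! ## The Science Fiction heuristic -/

/-- The space `M^ε` spanned by `B^ε`, for the word `ε` with `ε_c = 1` exactly for `c ∈ S`:
`B^ε` consists of the elements of `B` that lie in `B_c` for `c ∈ S` and outside `B_c` for
`c ∉ S`. -/
def wordModule {n : ℕ} {μ : YoungDiagram} (B : Set (PolyXY n)) (Bc : Corner μ → Set (PolyXY n))
    (S : Finset (Corner μ)) : Submodule ℚ (PolyXY n) :=
  Submodule.span ℚ {b | b ∈ B ∧ ∀ c, b ∈ Bc c ↔ c ∈ S}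

/-- `B`, with its subsets `B_c`, is a basis of `V_μ = ∑_c M_{pred μ c}` as postulated by the Science
Fiction heuristic: it consists of bihomogeneous polynomials, `B_c` spans the module of the
predecessor at `c`, the spaces `M^ε` are `S_n`-invariant, and for `ε_c = 1` the flip at `c` carries
`M^ε` to a space isomorphic (as bigraded `S_n`-module) to `M^{τ_c ε}`, where `τ_c` complements all
letters of `ε` but the one at `c`. The further postulates of the heuristic (on orthogonality and on
dimensions) are not assumed. -/
structure IsSFBasis {n : ℕ} {μ : YoungDiagram} (hμ : μ.card = n + 1) (B : Set (PolyXY n))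
    (Bc : Corner μ → Set (PolyXY n)) : Prop where
  linearIndependent : LinearIndepOn ℚ id B
  span_eq : Submodule.span ℚ B = ⨆ c, Mc hμ c
  bihomogeneous : ∀ b ∈ B, ∃ d : ℕ × ℕ, IsWeightedHomogeneous (bideg n) b d
  subset : ∀ c, Bc c ⊆ B
  span_subset : ∀ c, Submodule.span ℚ (Bc c) = Mc hμ c
  invariant : ∀ (S : Finset (Corner μ)) (σ : Equiv.Perm (Fin n)),
    ∀ P ∈ wordModule B Bc S, diagAct σ P ∈ wordModule B Bc S
  flip_iso : ∀ (S : Finset (Corner μ)) (c : Corner μ), c ∈ S →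
    BigradedIso ((wordModule B Bc S).map (flip (pred μ c) (card_pred hμ c)))
      (wordModule B Bc (insert c Sᶜ))

/-- `Φ_μ = ∑_j (∏_{s ≠ j} 1/(1 - T_j/T_s)) H̃_j`. -/
def PhiMu (μ : YoungDiagram) : SymFun Qqt :=
  ∑ j : Corner μ, (∏ s ∈ Finset.univ.erase j, (1 - Tc j / Tc s)⁻¹) • Hc j

/-- The operator `∏_{i ∈ S} (1 - ∇/T_i)`, a polynomial in `∇`. -/
def nablaProd {μ : YoungDiagram} (S : Finset (Corner μ)) : Module.End Qqt (SymFun Qqt) :=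
  Polynomial.aeval nabla
    (∏ i ∈ S, (1 - Polynomial.C (Tc i)⁻¹ * Polynomial.X : Polynomial Qqt))

end ScienceFiction

end

noncomputable section

namespace ScienceFiction

open MvPolynomial

/-! ## Linear independence of the modified Macdonald polynomials -/

/-! The mechanism is a comparison of flips. On $\mathbf M_{\alpha^{(i)}}$ the flip is injective,
since the apolar form is positive definite. It reverses bidegrees inside that of $\Delta$ and twists
the action by the sign. Hence $\mathcal F(\mathbf{flip}\,V)=T_i\,D(V)$, where $D(V)$ does not
involve $i$ (`frobenius_map_flip`). For $i\notin R$, postulate 3 applied to the complement of $R$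
gives $\Phi^{=R\cup\{i\}}=T_i\,D(\mathbf M^{=R^c})$. Multiplying by $\prod_{j\notin R\cup\{i\}}T_j$
removes the dependence on $i$. So $\prod_{j\notin S}T_j\,\Phi^{=S}$ survives the exchange of one
element of $S$ and depends only on $|S|$ (`prod_smul_frobenius_eq`); this defines $\Phi^{(k)}$.

As $\mathcal B$ is a basis, $\Phi^{\supseteq S}$ is the sum of $\Phi^{=R}$ over $R\supseteq S$
(`frobenius_iInf_Mc`). For $S=\{i\}$ this expresses each $\widetilde H_{\alpha^{(i)}}$ through the
$\Phi^{(k)}$ by a square matrix of elementary symmetric functions. Its inverse is of Lagrange type,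
because $\prod_{i\ne c}(1-T_j/T_i)$ vanishes for $j\ne c$ (`eq_sum_lagrangeCoeff_smul`). The
resulting formula for $\Phi^{(k)}$ is $(-\nabla)^{m-k}\Phi_\mu$, the $\widetilde H_{\alpha^{(j)}}$
being eigenvectors (`aeval_nabla_PhiMu`).

To know that `nabla` really has these eigenvectors, the $\widetilde H_\nu$ must be linearly
independent (`linearIndependent_Htilde`). This comes from Jacobi–Trudi, triangular in the products
of complete functions, followed by Gram–Schmidt. -/

/-- A family that is triangular, with nonzero diagonal, against a family of functionals is linearly
independent. -/
theorem linearIndependent_of_triangular {ι K V β : Type*} [Field K] [AddCommGroup V] [Module K V]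
    [LinearOrder β] (f : ι → V) (φ : ι → V →ₗ[K] K) (w : ι → β) (h1 : ∀ i, φ i (f i) ≠ 0)
    (h2 : ∀ i j, i ≠ j → w i ≤ w j → φ i (f j) = 0) : LinearIndependent K f := by
  rw [linearIndependent_iff]
  intro l hl
  by_contra hne
  obtain ⟨i, hi, hmin⟩ := l.support.exists_min_image w (Finsupp.support_nonempty_iff.2 hne)
  have h := congrArg (φ i) hl
  rw [Finsupp.linearCombination_apply, Finsupp.sum, map_sum, map_zero,
    Finset.sum_eq_single_of_mem i hi] at h
  · rw [map_smul, smul_eq_mul, mul_eq_zero] at h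
    exact h.elim (Finsupp.mem_support_iff.1 hi) (h1 i)
  · intro j hj hji
    rw [map_smul, h2 i j hji.symm (hmin j hj), smul_zero]

/-- A family that is unitriangular with respect to a linearly independent family is linearly
independent. -/
theorem linearIndependent_of_sub_mem_span {ι K V β : Type*} [Field K] [AddCommGroup V] [Module K V]
    [LinearOrder β] {v u : ι → V} (hv : LinearIndependent K v) (w : ι → β)
    (h : ∀ i, u i - v i ∈ Submodule.span K (v '' {j | w j < w i})) : LinearIndependent K u := by
  have hφ : ∀ i, ∃ φ : V →ₗ[K] K, ∀ j, φ (v j) = Finsupp.single j (1 : K) i := by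
    intro i
    obtain ⟨g, hg⟩ := LinearMap.exists_extend
      ((Finsupp.lapply i : (ι →₀ K) →ₗ[K] K) ∘ₗ hv.repr)
    refine ⟨g, fun j => ?_⟩
    have h1 := LinearMap.congr_fun hg ⟨v j, Submodule.subset_span ⟨j, rfl⟩⟩
    simp only [LinearMap.comp_apply, Submodule.subtype_apply] at h1
    rw [h1, hv.repr_eq_single j _ rfl]
    rfl
  choose φ hφ using hφ
  have key : ∀ i j, w j ≤ w i → φ i (u j) = φ i (v j) := by
    intro i j hij
    rw [← sub_eq_zero, ← map_sub]
    have hle : Submodule.span K (v '' {k | w k < w j}) ≤ LinearMap.ker (φ i) := by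
      rw [Submodule.span_le]
      rintro _ ⟨k, hk, rfl⟩
      rw [SetLike.mem_coe, LinearMap.mem_ker, hφ, Finsupp.single_apply_eq_zero]
      rintro rfl
      exact absurd hij (not_le.2 hk)
    exact hle (h j)
  refine linearIndependent_of_triangular u φ (fun i => OrderDual.toDual (w i)) (fun i => ?_)
    fun i j hij hw => ?_
  · rw [key i i le_rfl, hφ, Finsupp.single_eq_same]
    exact one_ne_zero
  · rw [key i j (OrderDual.toDual_le_toDual.1 hw), hφ, Finsupp.single_eq_of_ne hij]

/-! ### Jacobi–Trudi determinants are triangular in the products $h_\nu$. -/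

section Schur

variable (K : Type*) [Field K]

/-- The exponent of the variable standing for `h_k`. -/
def completeExp (k : ℕ) : ℕ+ →₀ ℕ := if k = 0 then 0 else Finsupp.single k.toPNat' 1

/-- The variable standing for `h_k`, with `h_0 = 1`. -/
def completeVar (k : ℕ) : SymFun K := monomial (completeExp k) 1

/-- The power sums as polynomials in the complete homogeneous symmetric functions. -/
def powerSumInComplete : ℕ → SymFun K
  | 0 => 0
  | n + 1 => C (n + 1 : K) * completeVar K (n + 1) -
      ∑ r : Fin n, powerSumInComplete (r + 1) * completeVar K (n - r)
termination_by n => n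
decreasing_by omega

/-- The substitution that expresses a symmetric function in the complete homogeneous symmetric
functions. -/
def toComplete : SymFun K →ₐ[K] SymFun K := aeval fun r : ℕ+ => powerSumInComplete K r

theorem toComplete_powerSum (r : ℕ) :
    toComplete K (powerSum K (r + 1)) = powerSumInComplete K (r + 1) := by
  rw [toComplete, powerSum, aeval_X]
  rfl

/-- Newton's recursion, solved for its last summand $p_{n+1}h_0$, is the definition of
`powerSumInComplete`; substituting it back makes all other summands cancel. -/
theorem toComplete_complete [CharZero K] (n : ℕ) : toComplete K (complete K n) = completeVar K n := by
  induction n using Nat.strong_induction_on with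
  | _ n ih =>
    cases n with
    | zero => rw [complete, map_one, completeVar, completeExp, if_pos rfl]; rfl
    | succ n =>
      have h0 : ((n : K) + 1) ≠ 0 := by exact_mod_cast n.succ_ne_zero
      rw [complete, map_mul, map_sum, Fin.sum_univ_castSucc]
      have h1 : ∀ r : Fin n, toComplete K (powerSum K ((r.castSucc : ℕ) + 1) *
          complete K (n - (r.castSucc : ℕ))) =
          powerSumInComplete K (r + 1) * completeVar K (n - r) := by
        intro r
        rw [map_mul, toComplete_powerSum, ih _ (by omega)]
        rfl
      rw [Finset.sum_congr rfl fun r _ => h1 r, map_mul, toComplete_powerSum, ih _ (by omega),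
        Fin.val_last, powerSumInComplete, Nat.sub_self]
      have h2 : completeVar K 0 = 1 := by rw [completeVar, completeExp, if_pos rfl]; rfl
      rw [h2, mul_one, add_sub_cancel, ← algebraMap_eq, AlgHom.commutes, algebraMap_eq,
        ← mul_assoc, ← C_mul, inv_mul_cancel₀ h0, C_1, one_mul]

/-- The exponent of the product `h_ν = ∏_i h_{ν_i}`. -/
def shapeExp (ν : YoungDiagram) : ℕ+ →₀ ℕ := ∑ i : Fin (ν.colLen 0), completeExp (ν.rowLen i)

/-- The sum of the squares of the parts of a partition. -/
def sqSum (ν : YoungDiagram) : ℕ := ∑ i : Fin (ν.colLen 0), ν.rowLen i ^ 2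

/-- Giving $h_r$ the weight $r^2$ makes the sum of squares of the parts a degree; Jacobi–Trudi is
triangular for this degree. -/
theorem weight_completeExp (k : ℕ) :
    Finsupp.weight (fun r : ℕ+ => (r : ℕ) ^ 2) (completeExp k) = k ^ 2 := by
  unfold completeExp
  split_ifs with h
  · simp [h]
  · simp [Finsupp.weight_single, Nat.toPNat'_coe, Nat.pos_of_ne_zero h]

theorem weight_shapeExp (ν : YoungDiagram) :
    Finsupp.weight (fun r : ℕ+ => (r : ℕ) ^ 2) (shapeExp ν) = sqSum ν := by
  simp only [shapeExp, map_sum, weight_completeExp, sqSum]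

theorem rowLen_pos_of_fin (ν : YoungDiagram) (i : Fin (ν.colLen 0)) : 0 < ν.rowLen i :=
  YoungDiagram.mem_iff_lt_rowLen.1 (YoungDiagram.mem_iff_lt_colLen.2 i.2)

/-- All rows met by the first column are nonempty, so no $h_0$ occurs and the exponent records the
multiset of parts; sorting recovers the diagram. -/
theorem shapeExp_injective : Function.Injective shapeExp := by
  have key : ∀ ν : YoungDiagram,
      ((Finsupp.toMultiset (shapeExp ν)).map (fun r : ℕ+ => (r : ℕ))) = (ν.rowLens : Multiset ℕ) := by
    intro ν
    have h1 : ∀ i : Fin (ν.colLen 0), Finsupp.toMultiset (completeExp (ν.rowLen i)) =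
        {(ν.rowLen i).toPNat'} := by
      intro i
      rw [completeExp, if_neg (rowLen_pos_of_fin ν i).ne', Finsupp.toMultiset_single, one_smul]
    have h2 : ∀ i : Fin (ν.colLen 0), Multiset.map (fun r : ℕ+ => (r : ℕ)) {(ν.rowLen i).toPNat'} =
        {ν.rowLen i} := by
      intro i
      rw [Multiset.map_singleton, Nat.toPNat'_coe, if_pos (rowLen_pos_of_fin ν i)]
    rw [shapeExp, map_sum, Finset.sum_congr rfl fun i _ => h1 i, ← Multiset.coe_mapAddMonoidHom,
      map_sum]
    simp only [Multiset.coe_mapAddMonoidHom, h2]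
    rw [Fin.sum_univ_eq_sum_range (fun i => ({ν.rowLen i} : Multiset ℕ)), YoungDiagram.rowLens,
      ← Multiset.map_coe, ← Multiset.sum_map_singleton (Multiset.map _ _), Multiset.map_map]
    rfl
  intro ν ν' h
  have h1 := key ν
  rw [h, key ν'] at h1
  have h2 : ν'.rowLens.Perm ν.rowLens := Multiset.coe_eq_coe.1 h1
  have h3 := h2.eq_of_pairwise' ν'.rowLens_sorted.pairwise ν.rowLens_sorted.pairwise
  exact YoungDiagram.equivListRowLens.injective (Subtype.ext h3.symm)

/-- The difference of the two sides is $2\sum\nu_i(\sigma(i)-i)+\sum(\sigma(i)-i)^2$. The first sum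
is nonnegative by the rearrangement inequality, as the rows decrease; the second is positive for
$\sigma\ne1$. -/
theorem sqSum_lt_of_perm (ν : YoungDiagram) (σ : Equiv.Perm (Fin (ν.colLen 0)))
    (h : ∀ i : Fin (ν.colLen 0), (i : ℕ) ≤ ν.rowLen i + σ i) (hσ : σ ≠ 1) :
    sqSum ν < ∑ i : Fin (ν.colLen 0), (ν.rowLen i + σ i - i) ^ 2 := by
  have hanti : Antivary (fun i : Fin (ν.colLen 0) => (ν.rowLen i : ℤ)) (fun i => (i : ℤ)) := by
    intro i j hij
    have : (i : ℕ) ≤ j := by simp only at hij; omega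
    exact Nat.cast_le.2 (ν.rowLen_anti i j this)
  have h1 := hanti.sum_smul_le_sum_smul_comp_perm (σ := σ)
  simp only [smul_eq_mul] at h1
  obtain ⟨k, hk⟩ : ∃ k, σ k ≠ k := by
    by_contra! hc
    exact hσ (Equiv.ext hc)
  have h2 : 0 < ∑ i, ((σ i : ℤ) - i) ^ 2 := by
    refine Finset.sum_pos' (fun i _ => sq_nonneg _) ⟨k, Finset.mem_univ _, ?_⟩
    have : (σ k : ℤ) - k ≠ 0 := by
      intro hc
      exact hk (Fin.ext (by omega))
    positivity
  zify
  have h3 : ∀ i : Fin (ν.colLen 0), (((ν.rowLen i + σ i - i : ℕ) : ℤ)) ^ 2 = (ν.rowLen i : ℤ) ^ 2 +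
      2 * (ν.rowLen i * (σ i : ℕ) - ν.rowLen i * (i : ℕ)) + ((σ i : ℤ) - i) ^ 2 := by
    intro i
    rw [Nat.cast_sub (h i)]
    push_cast
    ring
  rw [Finset.sum_congr rfl fun i _ => h3 i, sqSum]
  push_cast
  rw [Finset.sum_add_distrib, Finset.sum_add_distrib, ← Finset.mul_sum, Finset.sum_sub_distrib]
  linarith

variable {K}

theorem toComplete_schur [CharZero K] (ν : YoungDiagram) :
    toComplete K (schur K ν) = ∑ σ : Equiv.Perm (Fin (ν.colLen 0)),
      Equiv.Perm.sign σ • ∏ i : Fin (ν.colLen 0),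
        if (i : ℕ) ≤ ν.rowLen i + σ i then completeVar K (ν.rowLen i + σ i - i) else 0 := by
  rw [schur, AlgHom.map_det, ← Matrix.det_transpose, Matrix.det_apply]
  refine Finset.sum_congr rfl fun σ _ => ?_
  congr 1
  refine Finset.prod_congr rfl fun i _ => ?_
  simp only [AlgHom.mapMatrix_apply, Matrix.transpose_apply, Matrix.map_apply, Matrix.of_apply,
    apply_ite (toComplete K), toComplete_complete, map_zero]

-- The identity permutation contributes $h_\nu$. Any other one contributes zero (a negative index)
-- or a monomial whose sum of squares exceeds that of $\nu$.
open Classical in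
theorem coeff_toComplete_schur [CharZero K] (ν lam : YoungDiagram) (h : sqSum lam ≤ sqSum ν) :
    coeff (shapeExp lam) (toComplete K (schur K ν)) = if lam = ν then 1 else 0 := by
  rw [toComplete_schur, coeff_sum, Finset.sum_eq_single_of_mem 1 (Finset.mem_univ _)]
  · have h1 : ∏ i : Fin (ν.colLen 0), (if (i : ℕ) ≤ ν.rowLen i + (1 : Equiv.Perm (Fin (ν.colLen 0))) i then
        completeVar K (ν.rowLen i + (1 : Equiv.Perm (Fin (ν.colLen 0))) i - i) else 0) =
        monomial (shapeExp ν) 1 := by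
      rw [shapeExp, monomial_sum_one]
      refine Finset.prod_congr rfl fun i _ => ?_
      rw [Equiv.Perm.one_apply, if_pos (by omega), Nat.add_sub_cancel]
      rfl
    rw [h1, Equiv.Perm.sign_one, one_smul, coeff_monomial]
    simp only [shapeExp_injective.eq_iff, eq_comm]
  · intro σ _ hσ
    have h0 : coeff (shapeExp lam) (∏ i : Fin (ν.colLen 0),
        if (i : ℕ) ≤ ν.rowLen i + σ i then completeVar K (ν.rowLen i + σ i - i) else 0) = 0 := by
      by_cases hle : ∀ i : Fin (ν.colLen 0), (i : ℕ) ≤ ν.rowLen i + σ i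
      · have h1 : (∏ i : Fin (ν.colLen 0),
            if (i : ℕ) ≤ ν.rowLen i + σ i then completeVar K (ν.rowLen i + σ i - i) else 0) =
            monomial (∑ i : Fin (ν.colLen 0), completeExp (ν.rowLen i + σ i - i)) 1 := by
          rw [monomial_sum_one]
          refine Finset.prod_congr rfl fun i _ => ?_
          rw [if_pos (hle i)]
          rfl
        rw [h1, coeff_monomial, if_neg]
        intro heq
        have h2 := congrArg (Finsupp.weight (fun r : ℕ+ => (r : ℕ) ^ 2)) heq
        rw [weight_shapeExp, map_sum, Finset.sum_congr rfl fun i _ => weight_completeExp _] at h2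
        have := sqSum_lt_of_perm ν σ hle hσ
        omega
      · push Not at hle
        obtain ⟨i, hi⟩ := hle
        rw [Finset.prod_eq_zero (Finset.mem_univ i) (if_neg (not_le.2 hi)), coeff_zero]
    rw [coeff_smul, h0, smul_zero]

theorem linearIndependent_schur [CharZero K] : LinearIndependent K (schur K) := by
  refine linearIndependent_of_triangular _
    (fun lam => lcoeff K (shapeExp lam) ∘ₗ (toComplete K).toLinearMap) sqSum (fun lam => ?_)
    fun lam ν hne hle => ?_
  · simp [coeff_toComplete_schur lam lam le_rfl]
  · simp [coeff_toComplete_schur ν lam hle, hne]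

end Schur

/-! ### From Schur functions to modified Macdonald polynomials and $\nabla$. -/

theorem macdonaldP_sub_schur_mem {K : Type*} [Field K] (q t : K) (lam : YoungDiagram) :
    macdonaldP q t lam - schur K lam ∈
      Submodule.span K (schur K '' {ν | (dominated ν).card < (dominated lam).card}) := by
  induction h : (dominated lam).card using Nat.strong_induction_on generalizing lam with
  | _ n ih =>
    subst h
    rw [macdonaldP, sub_sub_cancel_left]
    refine Submodule.neg_mem _ (Submodule.sum_mem _ fun ν _ => Submodule.smul_mem _ _ ?_)
    -- Gram–Schmidt only subtracts multiples of lower $P_\nu$; the values of the coefficients are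
    -- irrelevant, so no norm has to be nonzero.
    have hlt := card_dominated_lt (mem_dominated.1 ν.2)
    rw [← sub_add_cancel (macdonaldP q t ν.1) (schur K ν.1)]
    refine Submodule.add_mem _ (Submodule.span_mono (Set.image_mono ?_) (ih _ hlt ν.1 rfl))
      (Submodule.subset_span ⟨ν.1, hlt, rfl⟩)
    exact fun κ (hκ : _ < _) => lt_trans hκ hlt

theorem linearIndependent_macdonaldP {K : Type*} [Field K] [CharZero K] (q t : K) :
    LinearIndependent K (macdonaldP q t) :=
  linearIndependent_of_sub_mem_span linearIndependent_schur _ (macdonaldP_sub_schur_mem q t)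

/-- The substitution $p_r\mapsto(1-t^r)p_r$ is a left inverse. -/
theorem plethysmDiv_injective {K : Type*} [Field K] {t : K} (ht : ∀ r : ℕ+, t ^ (r : ℕ) ≠ 1) :
    Function.Injective (plethysmDiv t) := by
  have h : (aeval fun r : ℕ+ => (C (1 - t ^ (r : ℕ)) * X r : SymFun K)).comp (plethysmDiv t) =
      AlgHom.id K _ := by
    refine MvPolynomial.algHom_ext fun r => ?_
    have hr : 1 - t ^ (r : ℕ) ≠ 0 := sub_ne_zero.2 (ht r).symm
    rw [AlgHom.comp_apply, plethysmDiv, aeval_X, map_mul, aeval_X, ← algebraMap_eq,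
      AlgHom.commutes, algebraMap_eq, ← mul_assoc, ← C_mul, inv_mul_cancel₀ hr, C_1, one_mul]
    rfl
  intro a b hab
  have h1 := congrArg (aeval fun r : ℕ+ => (C (1 - t ^ (r : ℕ)) * X r : SymFun K)) hab
  rwa [← AlgHom.comp_apply, ← AlgHom.comp_apply, h, AlgHom.id_apply, AlgHom.id_apply] at h1

theorem monomial_qt_injective {a b c d : ℕ}
    (h : tvar ^ a * qvar ^ b = tvar ^ c * qvar ^ d) : a = c ∧ b = d := by
  simp only [tvar, qvar, ← map_pow, ← map_mul] at h
  have h1 := FaithfulSMul.algebraMap_injective (MvPolynomial (Fin 2) ℚ) Qqt h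
  simp only [X_pow_eq_monomial, monomial_mul, mul_one] at h1
  have h2 := monomial_left_injective (one_ne_zero) h1
  have h3 := DFunLike.congr_fun h2 0
  have h4 := DFunLike.congr_fun h2 1
  simp at h3 h4
  exact ⟨h4, h3⟩

theorem tvar_ne_zero : tvar ≠ 0 := by
  intro h
  -- If $t$ were zero, the monomials $t$ and $t^2$ would coincide.
  have := @monomial_qt_injective 1 0 2 0 (by simp [h])
  omega

theorem qvar_ne_zero : qvar ≠ 0 := by
  intro h
  have := @monomial_qt_injective 0 1 0 2 (by simp [h])
  omega

/-- An injective substitution and nonzero scalars lead from $P_\nu$ to $\widetilde H_\nu$. The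
factors $1-q^at^{-(l+1)}$ do not vanish because $l+1>0$. -/
theorem linearIndependent_Htilde : LinearIndependent Qqt Htilde := by
  have h1 : ∀ r : ℕ+, tvar⁻¹ ^ (r : ℕ) ≠ 1 := by
    intro r hr
    rw [inv_pow, inv_eq_one] at hr
    have := @monomial_qt_injective r 0 0 0 (by simpa using hr)
    exact r.pos.ne' this.1
  have h2 : ∀ ν : YoungDiagram, tvar ^ (∑ s ∈ ν.cells, s.1) *
      ∏ s ∈ ν.cells, (1 - qvar ^ arm ν s * tvar⁻¹ ^ (leg ν s + 1)) ≠ 0 := by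
    intro ν
    refine mul_ne_zero (pow_ne_zero _ tvar_ne_zero) (Finset.prod_ne_zero_iff.2 fun s _ => ?_)
    intro hs
    rw [sub_eq_zero, inv_pow, eq_mul_inv_iff_mul_eq₀ (pow_ne_zero _ tvar_ne_zero)] at hs
    have := @monomial_qt_injective (leg ν s + 1) 0 0 (arm ν s) (by simpa using hs)
    omega
  have h3 := ((linearIndependent_macdonaldP qvar tvar⁻¹).map'
    (plethysmDiv tvar⁻¹).toLinearMap (LinearMap.ker_eq_bot.2 (plethysmDiv_injective h1))).units_smul
      fun ν => Units.mk0 _ (h2 ν)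
  refine (?_ : _ = Htilde) ▸ h3
  funext ν
  simp [Htilde, modifiedH, macdonaldH, macdonaldJ, Units.smul_def, mul_smul]

/-- Linear independence alone provides an operator with these eigenvectors: it is defined on the
span and extended arbitrarily. Hence the default value in `nabla` is never taken. -/
theorem nabla_Htilde (ν : YoungDiagram) : nabla (Htilde ν) = Tmon ν • Htilde ν := by
  have h : ∃ L : Module.End Qqt (SymFun Qqt), ∀ ν, L (Htilde ν) = Tmon ν • Htilde ν := by
    obtain ⟨g, hg⟩ := LinearMap.exists_extend
      ((Finsupp.linearCombination Qqt fun ν => Tmon ν • Htilde ν) ∘ₗ linearIndependent_Htilde.repr)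
    refine ⟨g, fun ν => ?_⟩
    have h1 := LinearMap.congr_fun hg ⟨Htilde ν, Submodule.subset_span ⟨ν, rfl⟩⟩
    simp only [LinearMap.comp_apply, Submodule.subtype_apply] at h1
    rw [h1, linearIndependent_Htilde.repr_eq_single ν _ rfl, Finsupp.linearCombination_single,
      one_smul]
  rw [nabla, dif_pos h]
  exact h.choose_spec ν

/-! ## Polynomials acting by differentiation -/

section Differentiation

variable {n : ℕ}

/-- The product of the factorials of the exponents. -/
def multiFactorial (m : Fin n ⊕ Fin n →₀ ℕ) : ℕ := ∏ v, (m v).factorial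

theorem multiFactorial_ne_zero (m : Fin n ⊕ Fin n →₀ ℕ) : (multiFactorial m : ℚ) ≠ 0 :=
  Nat.cast_ne_zero.2 (Finset.prod_ne_zero_iff.2 fun _ _ => Nat.factorial_ne_zero _)

theorem multiFactorial_add_single (m : Fin n ⊕ Fin n →₀ ℕ) (v : Fin n ⊕ Fin n) :
    multiFactorial (m + Finsupp.single v 1) = (m v + 1) * multiFactorial m := by
  classical
  rw [multiFactorial, multiFactorial, ← Finset.mul_prod_erase _ _ (Finset.mem_univ v),
    ← Finset.mul_prod_erase _ (fun w => (m w).factorial) (Finset.mem_univ v), ← mul_assoc,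
    Finsupp.add_apply, Finsupp.single_eq_same, Nat.factorial_succ]
  congr 1
  refine Finset.prod_congr rfl fun w hw => ?_
  rw [Finsupp.add_apply, Finsupp.single_eq_of_ne (Finset.ne_of_mem_erase hw), add_zero]

/-- Once the coefficient at $m$ is multiplied by $m!$, differentiation becomes a shift of exponents.
Commutation, equivariance and degree statements can then be read off from coefficients. -/
theorem coeff_partialD_pow (v : Fin n ⊕ Fin n) (k : ℕ) (f : PolyXY n) (m : Fin n ⊕ Fin n →₀ ℕ) :
    multiFactorial m * coeff m ((partialD v ^ k) f) =
      multiFactorial (m + Finsupp.single v k) * coeff (m + Finsupp.single v k) f := by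
  induction k generalizing m with
  | zero => simp
  | succ k ih =>
    rw [pow_succ', Module.End.mul_apply]
    have h : coeff m (partialD v ((partialD v ^ k) f)) =
        coeff (m + Finsupp.single v 1) ((partialD v ^ k) f) * (m v + 1) := coeff_pderiv _ _
    have h2 := ih (m + Finsupp.single v 1)
    rw [add_assoc, ← Finsupp.single_add, add_comm 1 k] at h2
    rw [h, ← h2, multiFactorial_add_single]
    push_cast
    ring

theorem coeff_partialDs (s : Fin n ⊕ Fin n →₀ ℕ) (f : PolyXY n) (m : Fin n ⊕ Fin n →₀ ℕ) :
    multiFactorial m * coeff m (partialDs s f) = multiFactorial (m + s) * coeff (m + s) f := by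
  classical
  have key : ∀ (F : Finset (Fin n ⊕ Fin n))
      (hF : (F : Set (Fin n ⊕ Fin n)).Pairwise
        (Function.onFun Commute fun v => (partialD v ^ s v : Module.End ℚ (PolyXY n))))
      (m : Fin n ⊕ Fin n →₀ ℕ),
      multiFactorial m * coeff m (F.noncommProd (fun v => partialD v ^ s v) hF f) =
      multiFactorial (m + ∑ v ∈ F, Finsupp.single v (s v)) *
        coeff (m + ∑ v ∈ F, Finsupp.single v (s v)) f := by
    intro F
    induction F using Finset.induction_on with
    | empty => intro _ m; simp
    | insert v F hv ih =>
      intro _ m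
      rw [Finset.noncommProd_insert_of_notMem _ _ _ _ hv, Module.End.mul_apply, coeff_partialD_pow,
        ih, Finset.sum_insert hv, add_assoc]
  have h := key Finset.univ (fun v _ w _ _ => (partialD_commute v w).pow_pow _ _) m
  rwa [Finsupp.univ_sum_single] at h

theorem coeff_partialDs_ne_zero {s m : Fin n ⊕ Fin n →₀ ℕ} {f : PolyXY n}
    (h : coeff m (partialDs s f) ≠ 0) : coeff (m + s) f ≠ 0 := by
  intro h0
  have h1 := coeff_partialDs s f m
  rw [h0, mul_zero, mul_eq_zero] at h1
  exact h1.elim (multiFactorial_ne_zero m) h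

theorem partialDs_comm (s r : Fin n ⊕ Fin n →₀ ℕ) (f : PolyXY n) :
    partialDs s (partialDs r f) = partialDs r (partialDs s f) := by
  ext m
  apply mul_left_cancel₀ (multiFactorial_ne_zero m)
  rw [coeff_partialDs, coeff_partialDs, coeff_partialDs, coeff_partialDs, add_right_comm]

theorem multiFactorial_mapDomain (e : Equiv.Perm (Fin n ⊕ Fin n)) (m : Fin n ⊕ Fin n →₀ ℕ) :
    multiFactorial (m.mapDomain e) = multiFactorial m := by
  rw [multiFactorial, multiFactorial, ← Equiv.prod_comp e]
  exact Finset.prod_congr rfl fun v _ => by rw [Finsupp.mapDomain_apply e.injective]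

theorem coeff_diagAct (σ : Equiv.Perm (Fin n)) (f : PolyXY n) (m : Fin n ⊕ Fin n →₀ ℕ) :
    coeff (m.mapDomain (Equiv.sumCongr σ σ)) (diagAct σ f) = coeff m f :=
  coeff_rename_mapDomain _ (Equiv.sumCongr σ σ).injective f m

theorem exists_mapDomain_eq (σ : Equiv.Perm (Fin n)) (m : Fin n ⊕ Fin n →₀ ℕ) :
    ∃ m', Finsupp.mapDomain (Equiv.sumCongr σ σ) m' = m :=
  ⟨m.mapDomain (Equiv.sumCongr σ σ).symm, by
    rw [← Finsupp.mapDomain_comp, Equiv.self_comp_symm, Finsupp.mapDomain_id]⟩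

theorem diagAct_partialDs (σ : Equiv.Perm (Fin n)) (s : Fin n ⊕ Fin n →₀ ℕ) (f : PolyXY n) :
    partialDs (s.mapDomain (Equiv.sumCongr σ σ)) (diagAct σ f) = diagAct σ (partialDs s f) := by
  ext m
  obtain ⟨m, rfl⟩ := exists_mapDomain_eq σ m
  apply mul_left_cancel₀ (multiFactorial_ne_zero (m.mapDomain (Equiv.sumCongr σ σ)))
  rw [coeff_partialDs, ← Finsupp.mapDomain_add, coeff_diagAct, coeff_diagAct,
    multiFactorial_mapDomain, multiFactorial_mapDomain, coeff_partialDs]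

/-- The map `P ↦ P(∂) Q`. -/
def applyD (Q : PolyXY n) : PolyXY n →ₗ[ℚ] PolyXY n :=
  (basisMonomials (Fin n ⊕ Fin n) ℚ).constr ℚ fun s => partialDs s Q

theorem applyD_monomial (Q : PolyXY n) (s : Fin n ⊕ Fin n →₀ ℕ) :
    applyD Q (monomial s 1) = partialDs s Q := by
  have h := (basisMonomials (Fin n ⊕ Fin n) ℚ).constr_basis ℚ (fun s => partialDs s Q) s
  rwa [coe_basisMonomials] at h

theorem applyD_apply (Q P : PolyXY n) :
    applyD Q P = ∑ s ∈ P.support, coeff s P • partialDs s Q := by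
  conv_lhs => rw [P.as_sum, map_sum]
  refine Finset.sum_congr rfl fun s _ => ?_
  rw [← applyD_monomial, ← map_smul, smul_monomial, smul_eq_mul, mul_one]

theorem applyD_smul (c : ℚ) (Q P : PolyXY n) : applyD (c • Q) P = c • applyD Q P := by
  simp only [applyD_apply, map_smul, Finset.smul_sum]
  exact Finset.sum_congr rfl fun s _ => smul_comm _ _ _

theorem applyD_partialDs (r : Fin n ⊕ Fin n →₀ ℕ) (Q P : PolyXY n) :
    applyD (partialDs r Q) P = partialDs r (applyD Q P) := by
  simp only [applyD_apply, map_sum, map_smul]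
  exact Finset.sum_congr rfl fun s _ => by rw [partialDs_comm]

theorem applyD_diagAct (σ : Equiv.Perm (Fin n)) (Q P : PolyXY n) :
    applyD (diagAct σ Q) (diagAct σ P) = diagAct σ (applyD Q P) := by
  have h : applyD (diagAct σ Q) ∘ₗ diagAct σ = diagAct σ ∘ₗ applyD Q := by
    refine (basisMonomials (Fin n ⊕ Fin n) ℚ).ext fun s => ?_
    rw [coe_basisMonomials, LinearMap.comp_apply, LinearMap.comp_apply, applyD_monomial,
      ← diagAct_partialDs, ← applyD_monomial]
    congr 1
    exact rename_monomial _ _ _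
  exact LinearMap.congr_fun h P

theorem weight_add_of_coeff_applyD_ne_zero {Q P : PolyXY n} {d D : ℕ × ℕ}
    (hQ : IsWeightedHomogeneous (bideg n) Q D) (hP : IsWeightedHomogeneous (bideg n) P d)
    {m : Fin n ⊕ Fin n →₀ ℕ} (h : coeff m (applyD Q P) ≠ 0) :
    Finsupp.weight (bideg n) m + d = D := by
  rw [applyD_apply, coeff_sum] at h
  obtain ⟨s, hs, h⟩ := Finset.exists_ne_zero_of_sum_ne_zero h
  rw [coeff_smul, smul_eq_mul] at h
  rw [← hP (mem_support_iff.1 hs), ← map_add]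
  exact hQ (coeff_partialDs_ne_zero (right_ne_zero_of_mul h))

/-- The constant term of $P(\partial)Q$ is the apolar pairing $\sum_s s!\,P_sQ_s$. -/
theorem coeff_zero_applyD (Q P : PolyXY n) :
    coeff 0 (applyD Q P) = ∑ s ∈ P.support, coeff s P * (multiFactorial s * coeff s Q) := by
  rw [applyD_apply, coeff_sum]
  refine Finset.sum_congr rfl fun s _ => ?_
  have h := coeff_partialDs s Q 0
  have h0 : multiFactorial (0 : Fin n ⊕ Fin n →₀ ℕ) = 1 := by simp [multiFactorial]
  rw [h0, Nat.cast_one, one_mul, zero_add] at h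
  rw [coeff_smul, h, smul_eq_mul]

/-- The apolar form is positive definite. -/
theorem eq_zero_of_coeff_zero_applyD_self {P : PolyXY n} (h : coeff 0 (applyD P P) = 0) : P = 0 := by
  rw [coeff_zero_applyD, Finset.sum_eq_zero_iff_of_nonneg] at h
  · by_contra hP
    obtain ⟨s, hs⟩ := Finset.nonempty_iff_ne_empty.2 (support_eq_empty.not.2 hP)
    have h1 := h s hs
    have h2 := mem_support_iff.1 hs
    exact mul_ne_zero h2 (mul_ne_zero (multiFactorial_ne_zero s) h2) h1
  · intro s _
    rw [mul_left_comm]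
    exact mul_nonneg (Nat.cast_nonneg _) (mul_self_nonneg _)

end Differentiation

/-! ## The modules `M_ν` and the flip maps -/

section Flip

variable {n : ℕ} (ν : YoungDiagram) (hν : ν.card = n)

theorem flip_eq_applyD : flip ν hν = applyD (Delta ν hν) := rfl

/-- The bidegree of `Δ_ν`. -/
def deltaDegree (ν : YoungDiagram) : ℕ × ℕ := ∑ s ∈ ν.cells, s

theorem Tmon_eq : Tmon ν = tvar ^ (deltaDegree ν).1 * qvar ^ (deltaDegree ν).2 := by
  rw [Tmon, Finset.prod_mul_distrib, Finset.prod_pow_eq_pow_sum, Finset.prod_pow_eq_pow_sum,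
    deltaDegree, Prod.fst_sum, Prod.snd_sum]

theorem exists_Delta_eq_det : ∃ e : Fin n → ℕ × ℕ, ∑ j, e j = deltaDegree ν ∧
    Delta ν hν = (Matrix.of fun i j : Fin n =>
      (X (Sum.inl i) ^ (e j).1 * X (Sum.inr i) ^ (e j).2 : PolyXY n)).det := by
  refine ⟨fun j => ofLex ((ν.cells.map toLex.toEmbedding).orderEmbOfFin
    ((Finset.card_map _).trans hν) j), ?_, rfl⟩
  have h1 := Finset.sum_map Finset.univ ((ν.cells.map toLex.toEmbedding).orderEmbOfFin
    ((Finset.card_map _).trans hν)).toEmbedding (fun x => ofLex x)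
  rw [Finset.map_orderEmbOfFin_univ, Finset.sum_map] at h1
  exact h1.symm

theorem isWeightedHomogeneous_Delta :
    IsWeightedHomogeneous (bideg n) (Delta ν hν) (deltaDegree ν) := by
  obtain ⟨e, he, hD⟩ := exists_Delta_eq_det ν hν
  rw [hD]
  rw [← Matrix.det_transpose, Matrix.det_apply]
  refine IsWeightedHomogeneous.sum _ _ _ fun σ _ => ?_
  rw [Units.smul_def, ← Int.cast_smul_eq_zsmul ℚ]
  refine Submodule.smul_mem (weightedHomogeneousSubmodule ℚ (bideg n) (deltaDegree ν)) _ ?_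
  rw [mem_weightedHomogeneousSubmodule, ← he, ← Equiv.sum_comp σ]
  refine IsWeightedHomogeneous.prod _ _ _ fun i _ => ?_
  have h1 := ((isWeightedHomogeneous_X ℚ (bideg n) (Sum.inl i)).pow (e (σ i)).1).mul
    ((isWeightedHomogeneous_X ℚ (bideg n) (Sum.inr i)).pow (e (σ i)).2)
  have h2 : (e (σ i)).1 • bideg n (Sum.inl i) + (e (σ i)).2 • bideg n (Sum.inr i) = e (σ i) := by
    ext <;> simp [bideg]
  rw [h2] at h1
  exact h1

/-- The diagonal action permutes the rows of the matrix. -/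
theorem diagAct_Delta (σ : Equiv.Perm (Fin n)) :
    diagAct σ (Delta ν hν) = ((Equiv.Perm.sign σ : ℤ) : ℚ) • Delta ν hν := by
  obtain ⟨e, -, hD⟩ := exists_Delta_eq_det ν hν
  rw [hD]
  have h := Matrix.det_permute σ (Matrix.of fun i j : Fin n =>
    (X (Sum.inl i) ^ (e j).1 * X (Sum.inr i) ^ (e j).2 : PolyXY n))
  rw [Algebra.smul_def, map_intCast, ← h]
  refine (AlgHom.map_det (rename (Sum.map σ σ) : PolyXY n →ₐ[ℚ] PolyXY n) _).trans ?_
  congr 1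
  ext1 i j
  simp [Matrix.submatrix_apply]

theorem sign_mul_self (σ : Equiv.Perm (Fin n)) :
    ((Equiv.Perm.sign σ : ℤ) : ℚ) * ((Equiv.Perm.sign σ : ℤ) : ℚ) = 1 := by
  rcases Int.units_eq_one_or (Equiv.Perm.sign σ) with h | h <;> simp [h]

theorem flip_diagAct (σ : Equiv.Perm (Fin n)) (P : PolyXY n) :
    flip ν hν (diagAct σ P) = ((Equiv.Perm.sign σ : ℤ) : ℚ) • diagAct σ (flip ν hν P) := by
  rw [flip_eq_applyD, ← applyD_diagAct, diagAct_Delta, applyD_smul, smul_smul, sign_mul_self,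
    one_smul]

/-- If $P(\partial)$ kills $\Delta_\nu$, it kills all derivatives of $\Delta_\nu$, hence all of
$\mathbf M_\nu$ and $P$ itself. Then $P(\partial)P=0$, and positivity of the apolar form applies. -/
theorem eq_zero_of_flip_eq_zero {P : PolyXY n} (hP : P ∈ GHModule ν hν) (h : flip ν hν P = 0) :
    P = 0 := by
  have key : ∀ Q ∈ GHModule ν hν, applyD Q P = 0 := by
    intro Q hQ
    induction hQ using Submodule.span_induction with
    | mem Q hQ =>
      obtain ⟨s, rfl⟩ := hQ
      rw [applyD_partialDs, ← flip_eq_applyD, h, map_zero]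
    | zero => simp [applyD_apply]
    | add Q Q' _ _ h1 h2 =>
      rw [applyD_apply] at *
      simp only [map_add, smul_add, Finset.sum_add_distrib, h1, h2, add_zero]
    | smul c Q _ h1 => rw [applyD_smul, h1, smul_zero]
  exact eq_zero_of_coeff_zero_applyD_self (by rw [key P hP, coeff_zero])

instance finiteDimensional_GHModule : FiniteDimensional ℚ (GHModule ν hν) := by
  refine Submodule.finiteDimensional_of_le
    (S₂ := restrictTotalDegree (Fin n ⊕ Fin n) ℚ (Delta ν hν).totalDegree) ?_
  refine Submodule.span_le.2 ?_
  rintro _ ⟨s, rfl⟩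
  rw [SetLike.mem_coe, mem_restrictTotalDegree]
  refine Finset.sup_le fun m hm => ?_
  have h := le_totalDegree (mem_support_iff.2 (coeff_partialDs_ne_zero (mem_support_iff.1 hm)))
  refine le_trans ?_ h
  rw [Finsupp.sum_add_index (by simp) (by simp)]
  exact Nat.le_add_right _ _

end Flip

/-! ## Traces on invariant subspaces -/

/-- The scalar $c$ lets one lemma serve direct sums and isomorphisms ($c=1$) as well as flips ($c$
the sign). -/
theorem traceOn_range {U E : Type*} [AddCommGroup U] [Module ℚ U] [AddCommGroup E] [Module ℚ E]
    (u : U →ₗ[ℚ] U) (φ : U →ₗ[ℚ] E) (hφ : Function.Injective φ) (f : E →ₗ[ℚ] E) (c : ℚ)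
    (h : ∀ x, f (φ x) = c • φ (u x)) {V : Submodule ℚ E} (hV : LinearMap.range φ = V) :
    traceOn f V = c * LinearMap.trace ℚ U u := by
  subst hV
  have hinv : ∀ v ∈ LinearMap.range φ, f v ∈ LinearMap.range φ := by
    rintro _ ⟨x, rfl⟩
    exact ⟨c • u x, by rw [map_smul, h]⟩
  rw [traceOn, dif_pos hinv, ← LinearMap.trace_conj' u (LinearEquiv.ofInjective φ hφ), ← smul_eq_mul,
    ← map_smul]
  congr 1
  ext ⟨_, x, rfl⟩
  have h1 : (LinearEquiv.ofInjective φ hφ).symm ⟨φ x, x, rfl⟩ = x :=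
    (LinearEquiv.ofInjective φ hφ).symm_apply_apply x
  simp [LinearEquiv.conj_apply, h1, h]

theorem traceOn_eq {E : Type*} [AddCommGroup E] [Module ℚ E] (f : E →ₗ[ℚ] E) {V : Submodule ℚ E}
    (h : ∀ v ∈ V, f v ∈ V) : traceOn f V = LinearMap.trace ℚ V (f.restrict h) := dif_pos h

theorem traceOn_bot {E : Type*} [AddCommGroup E] [Module ℚ E] (f : E →ₗ[ℚ] E) :
    traceOn f ⊥ = 0 := by
  rw [traceOn_eq f (by rintro v rfl; simp), Subsingleton.elim (f.restrict _) 0, map_zero]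

theorem traceOn_sup {E : Type*} [AddCommGroup E] [Module ℚ E] (f : E →ₗ[ℚ] E)
    {V W : Submodule ℚ E} [FiniteDimensional ℚ V] [FiniteDimensional ℚ W] (hVW : Disjoint V W)
    (hV : ∀ v ∈ V, f v ∈ V) (hW : ∀ v ∈ W, f v ∈ W) :
    traceOn f (V ⊔ W) = traceOn f V + traceOn f W := by
  rw [traceOn_range ((f.restrict hV).prodMap (f.restrict hW)) (V.subtype.coprod W.subtype) ?_ f 1 ?_
    ?_, one_mul, LinearMap.trace_prodMap', traceOn_eq f hV, traceOn_eq f hW]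
  · rw [← LinearMap.ker_eq_bot, LinearMap.ker_coprod_of_disjoint_range] <;> simp [hVW]
  · rintro ⟨v, w⟩
    simp
  · rw [LinearMap.range_coprod, Submodule.range_subtype, Submodule.range_subtype]

/-! ## Bigraded invariant subspaces -/

section Bigraded

variable {n : ℕ}

/-- The bihomogeneous polynomials of bidegree `d`. -/
abbrev bihom (n : ℕ) (d : ℕ × ℕ) : Submodule ℚ (PolyXY n) :=
  weightedHomogeneousSubmodule ℚ (bideg n) d

/-- The bihomogeneous component of bidegree `d`. -/
abbrev component (n : ℕ) (d : ℕ × ℕ) : PolyXY n →ₗ[ℚ] PolyXY n :=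
  weightedHomogeneousComponent (bideg n) d

/-- A subspace containing the bihomogeneous components of its elements. -/
def IsBigraded (V : Submodule ℚ (PolyXY n)) : Prop := ∀ v ∈ V, ∀ d, component n d v ∈ V

/-- A subspace stable under the diagonal action. -/
def IsInvariant (V : Submodule ℚ (PolyXY n)) : Prop :=
  ∀ σ : Equiv.Perm (Fin n), ∀ v ∈ V, diagAct σ v ∈ V

theorem component_of_mem {d e : ℕ × ℕ} {v : PolyXY n} (h : v ∈ bihom n e) :
    component n d v = if d = e then v else 0 :=
  weightedHomogeneousComponent_of_mem h

theorem component_mem (d : ℕ × ℕ) (v : PolyXY n) : component n d v ∈ bihom n d :=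
  weightedHomogeneousComponent_mem _ _ _

theorem isBigraded_span {A : Set (PolyXY n)}
    (hA : ∀ a ∈ A, ∃ d, IsWeightedHomogeneous (bideg n) a d) :
    IsBigraded (Submodule.span ℚ A) := by
  intro v hv d
  induction hv using Submodule.span_induction with
  | mem a ha =>
    obtain ⟨e, he⟩ := hA a ha
    rw [component_of_mem he]
    split_ifs
    · exact Submodule.subset_span ha
    · exact zero_mem _
  | zero => rw [map_zero]; exact zero_mem _
  | add v w _ _ hv hw => rw [map_add]; exact add_mem hv hw
  | smul c v _ hv => rw [map_smul]; exact Submodule.smul_mem _ _ hv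

theorem IsBigraded.sup {V W : Submodule ℚ (PolyXY n)} (hV : IsBigraded V) (hW : IsBigraded W) :
    IsBigraded (V ⊔ W) := by
  intro x hx d
  obtain ⟨v, hv, w, hw, rfl⟩ := Submodule.mem_sup.1 hx
  rw [map_add]
  exact Submodule.add_mem_sup (hV v hv d) (hW w hw d)

theorem IsInvariant.sup {V W : Submodule ℚ (PolyXY n)} (hV : IsInvariant V) (hW : IsInvariant W) :
    IsInvariant (V ⊔ W) := by
  intro σ x hx
  obtain ⟨v, hv, w, hw, rfl⟩ := Submodule.mem_sup.1 hx
  rw [map_add]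
  exact Submodule.add_mem_sup (hV σ v hv) (hW σ w hw)

/-- Distributivity fails for general subspaces; here projection to the component of degree $d$
preserves both summands. -/
theorem IsBigraded.sup_inf_bihom {V W : Submodule ℚ (PolyXY n)} (hV : IsBigraded V)
    (hW : IsBigraded W) (d : ℕ × ℕ) :
    (V ⊔ W) ⊓ bihom n d = V ⊓ bihom n d ⊔ W ⊓ bihom n d := by
  refine le_antisymm ?_ (le_inf (sup_le_sup inf_le_left inf_le_left)
    (sup_le inf_le_right inf_le_right))
  rintro x ⟨hx, hd⟩
  obtain ⟨v, hv, w, hw, rfl⟩ := Submodule.mem_sup.1 hx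
  have h := component_of_mem (d := d) hd
  rw [if_pos rfl, map_add] at h
  rw [← h]
  exact Submodule.add_mem_sup ⟨hV v hv d, component_mem d v⟩ ⟨hW w hw d, component_mem d w⟩

theorem weight_mapDomain (σ : Equiv.Perm (Fin n)) (m : Fin n ⊕ Fin n →₀ ℕ) :
    Finsupp.weight (bideg n) (m.mapDomain (Equiv.sumCongr σ σ)) = Finsupp.weight (bideg n) m := by
  induction m using Finsupp.induction_linear with
  | zero => simp
  | add f g hf hg => rw [Finsupp.mapDomain_add, map_add, map_add, hf, hg]
  | single v k =>
    rw [Finsupp.mapDomain_single, Finsupp.weight_single, Finsupp.weight_single]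
    rcases v with v | v <;> rfl

theorem diagAct_mem_bihom (σ : Equiv.Perm (Fin n)) {d : ℕ × ℕ} {v : PolyXY n}
    (hv : v ∈ bihom n d) : diagAct σ v ∈ bihom n d := by
  intro m hm
  obtain ⟨m, rfl⟩ := exists_mapDomain_eq σ m
  rw [coeff_diagAct] at hm
  rw [weight_mapDomain]
  exact hv hm

theorem IsInvariant.inf_bihom {V : Submodule ℚ (PolyXY n)} (hV : IsInvariant V)
    (d : ℕ × ℕ) (σ : Equiv.Perm (Fin n)) :
    ∀ v ∈ V ⊓ bihom n d, diagAct σ v ∈ V ⊓ bihom n d :=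
  fun v hv => ⟨hV σ v hv.1, diagAct_mem_bihom σ hv.2⟩

/-- A `finsum` with infinite support is zero by convention, so additivity of the bigraded character
needs this finiteness. -/
theorem finite_bidegrees (V : Submodule ℚ (PolyXY n)) [FiniteDimensional ℚ V] :
    {d | V ⊓ bihom n d ≠ ⊥}.Finite := by
  obtain ⟨A, hA⟩ := (Submodule.fg_iff_finiteDimensional V).2 inferInstance
  have hV : V ≤ restrictSupport ℚ (↑(A.biUnion support) : Set (Fin n ⊕ Fin n →₀ ℕ)) := by
    rw [← hA, Submodule.span_le]
    intro a ha
    rw [SetLike.mem_coe, mem_restrictSupport_iff]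
    exact Finset.coe_subset.2 (Finset.subset_biUnion_of_mem support ha)
  refine ((A.biUnion support).image (Finsupp.weight (bideg n))).finite_toSet.subset fun d hd => ?_
  obtain ⟨v, hv, h0⟩ := Submodule.exists_mem_ne_zero_of_ne_bot hd
  obtain ⟨m, hm⟩ := Finset.nonempty_iff_ne_empty.2 (support_eq_empty.not.2 h0)
  exact Finset.mem_coe.2 (Finset.mem_image.2 ⟨m, (mem_restrictSupport_iff ℚ).1 (hV hv.1) hm,
    hv.2 (mem_support_iff.1 hm)⟩)

/-! ## Bigraded characters -/

theorem finite_support_char (V : Submodule ℚ (PolyXY n)) [FiniteDimensional ℚ V]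
    (c : ℕ × ℕ → Qqt) (σ : Equiv.Perm (Fin n)) :
    (Function.support fun d : ℕ × ℕ =>
      c d * algebraMap ℚ Qqt (traceOn (diagAct σ) (V ⊓ bihom n d))).Finite := by
  refine (finite_bidegrees V).subset fun d hd hbot => hd ?_
  simp only [hbot, traceOn_bot, map_zero, mul_zero]

theorem bigradedChar_sup {V W : Submodule ℚ (PolyXY n)} [FiniteDimensional ℚ V]
    [FiniteDimensional ℚ W] (hVW : Disjoint V W) (hV : IsBigraded V) (hW : IsBigraded W)
    (hV' : IsInvariant V) (hW' : IsInvariant W) (σ : Equiv.Perm (Fin n)) :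
    bigradedChar (V ⊔ W) σ = bigradedChar V σ + bigradedChar W σ := by
  rw [bigradedChar, bigradedChar, bigradedChar,
    ← finsum_add_distrib (finite_support_char V _ σ) (finite_support_char W _ σ)]
  refine finsum_congr fun d => ?_
  rw [hV.sup_inf_bihom hW, traceOn_sup _ (hVW.mono inf_le_left inf_le_left) (hV'.inf_bihom d σ)
    (hW'.inf_bihom d σ), map_add, mul_add]

theorem frobenius_sup {V W : Submodule ℚ (PolyXY n)} [FiniteDimensional ℚ V]
    [FiniteDimensional ℚ W] (hVW : Disjoint V W) (hV : IsBigraded V) (hW : IsBigraded W)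
    (hV' : IsInvariant V) (hW' : IsInvariant W) :
    frobenius (V ⊔ W) = frobenius V + frobenius W := by
  simp only [frobenius, bigradedChar_sup hVW hV hW hV' hW', add_smul, Finset.sum_add_distrib,
    smul_add]

theorem frobenius_bot : frobenius (⊥ : Submodule ℚ (PolyXY n)) = 0 := by
  simp [frobenius, bigradedChar, traceOn_bot]

/-! ### Invariance of the Frobenius characteristic under bigraded isomorphism. -/

theorem component_bigradedIso {V W : Submodule ℚ (PolyXY n)} (hV : IsBigraded V) (e : V ≃ₗ[ℚ] W)
    (he : ∀ (d : ℕ × ℕ) (P : V), IsWeightedHomogeneous (bideg n) (P : PolyXY n) d →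
      IsWeightedHomogeneous (bideg n) (e P : PolyXY n) d) (v : V) (d : ℕ × ℕ) :
    component n d (e v) = e ⟨component n d v, hV v v.2 d⟩ := by
  have hfin := weightedHomogeneousComponent_finsupp (w := bideg n) (v : PolyXY n)
  have hsum : v = ∑ d' ∈ hfin.toFinset, ⟨component n d' v, hV v v.2 d'⟩ := by
    ext1
    rw [AddSubmonoidClass.coe_finsetSum]
    conv_lhs => rw [← sum_weightedHomogeneousComponent (bideg n) (v : PolyXY n)]
    exact finsum_eq_sum _ hfin
  conv_lhs => rw [hsum]
  rw [map_sum, AddSubmonoidClass.coe_finsetSum, map_sum]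
  rw [Finset.sum_eq_single d]
  · rw [component_of_mem (he d _ (component_mem d _)), if_pos rfl]
  · intro d' _ hne
    rw [component_of_mem (he d' _ (component_mem d' _)), if_neg hne.symm]
  · intro hd
    have h0 : (⟨component n d v, hV v v.2 d⟩ : V) = 0 := by
      ext1
      by_contra hne
      exact hd (hfin.mem_toFinset.2 hne)
    rw [h0, map_zero, Submodule.coe_zero, map_zero]

theorem BigradedIso.frobenius_eq {V W : Submodule ℚ (PolyXY n)} (h : BigradedIso V W)
    (hV : IsBigraded V) (hV' : IsInvariant V) : frobenius V = frobenius W := by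
  obtain ⟨e, he, hd⟩ := h
  have key : ∀ σ, bigradedChar V σ = bigradedChar W σ := by
    intro σ
    refine finsum_congr fun d => ?_
    congr 2
    rw [traceOn_eq _ (hV'.inf_bihom d σ), traceOn_range ((diagAct σ).restrict (hV'.inf_bihom d σ))
      (W.subtype ∘ₗ e.toLinearMap ∘ₗ Submodule.inclusion inf_le_left) ?_ (diagAct σ) 1 ?_ ?_,
      one_mul]
    · exact W.injective_subtype.comp (e.injective.comp (Submodule.inclusion_injective _))
    · intro x
      rw [one_smul]
      exact (he σ _ _ rfl).symm
    · ext w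
      constructor
      · rintro ⟨x, rfl⟩
        exact ⟨(e _).2, hd d _ x.2.2⟩
      · rintro ⟨hw, hwd⟩
        obtain ⟨v, hv⟩ := e.surjective ⟨w, hw⟩
        -- The preimage of a bihomogeneous element equals its own component of degree $d$, so $e$
        -- maps the graded piece of $V$ onto that of $W$.
        have h1 := component_bigradedIso hV e hd v d
        have hw' : (e v : PolyXY n) = w := by rw [hv]
        rw [hw', component_of_mem hwd, if_pos rfl, ← hw', Subtype.coe_inj, e.injective.eq_iff] at h1
        refine ⟨⟨v, v.2, ?_⟩, hw'⟩
        rw [h1]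
        exact component_mem d _
  simp only [frobenius, key]

/-! ### Behaviour of the Frobenius characteristic under the flip. -/

/-- The character `∑_d t^{-d_1} q^{-d_2} tr(σ | V_d)`. -/
def dualChar (V : Submodule ℚ (PolyXY n)) (σ : Equiv.Perm (Fin n)) : Qqt :=
  ∑ᶠ d : ℕ × ℕ, (tvar ^ d.1 * qvar ^ d.2)⁻¹ *
    algebraMap ℚ Qqt (traceOn (diagAct σ) (V ⊓ bihom n d))

/-- The symmetric function with coefficients `sgn(σ) dualChar V σ`. -/
def dualFrobenius (V : Submodule ℚ (PolyXY n)) : SymFun Qqt :=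
  (n.factorial : Qqt)⁻¹ • ∑ σ : Equiv.Perm (Fin n),
    (algebraMap ℚ Qqt ((Equiv.Perm.sign σ : ℤ) : ℚ) * dualChar V σ) •
      (σ.partition.parts.map (powerSum Qqt)).prod

section

variable (ν : YoungDiagram) (hν : ν.card = n)

/-- A differential operator of degree $e$ lowers degrees by $e$, so degree $d$ comes from
$\deg\Delta_\nu-d$. The guard is needed because this subtraction is truncated. -/
theorem component_flip (d : ℕ × ℕ) (v : PolyXY n) : component n d (flip ν hν v) =
    if d ≤ deltaDegree ν then flip ν hν (component n (deltaDegree ν - d) v) else 0 := by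
  have hmon : ∀ s m, coeff m (flip ν hν (monomial s 1)) ≠ 0 →
      Finsupp.weight (bideg n) m + Finsupp.weight (bideg n) s = deltaDegree ν := fun s m hm =>
    weight_add_of_coeff_applyD_ne_zero (isWeightedHomogeneous_Delta ν hν)
      (isWeightedHomogeneous_monomial _ _ _ rfl) hm
  have key : component n d ∘ₗ flip ν hν = if d ≤ deltaDegree ν then
      flip ν hν ∘ₗ component n (deltaDegree ν - d) else 0 := by
    refine (basisMonomials (Fin n ⊕ Fin n) ℚ).ext fun s => ?_
    rw [coe_basisMonomials]
    ext m
    rw [LinearMap.comp_apply, coeff_weightedHomogeneousComponent]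
    have hs : (monomial s 1 : PolyXY n) ∈ bihom n (Finsupp.weight (bideg n) s) :=
      isWeightedHomogeneous_monomial _ _ _ rfl
    by_cases h0 : coeff m (flip ν hν (monomial s 1)) = 0
    · rw [h0, ite_self]
      split_ifs
      · rw [LinearMap.comp_apply, component_of_mem hs]
        split_ifs
        · exact h0.symm
        · rw [map_zero, coeff_zero]
      · rfl
    · have hw := hmon s m h0
      by_cases hd : Finsupp.weight (bideg n) m = d
      · rw [if_pos hd]
        have hle : d ≤ deltaDegree ν := by rw [← hw, hd]; exact le_self_add
        rw [if_pos hle, LinearMap.comp_apply, component_of_mem hs, if_pos]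
        rw [← hw, hd, add_tsub_cancel_left]
      · rw [if_neg hd]
        split_ifs with hle
        · rw [LinearMap.comp_apply, component_of_mem hs, if_neg, map_zero, coeff_zero]
          intro h1
          apply hd
          rw [← h1] at hw
          have h2 := tsub_add_cancel_of_le hle
          rw [add_comm, ← h2] at hw
          exact add_left_cancel (hw.trans (by rw [add_tsub_cancel_right]))
        · rfl
  have h := LinearMap.congr_fun key v
  rw [LinearMap.comp_apply] at h
  rw [h]
  split_ifs <;> rfl

theorem isBigraded_map_flip {V : Submodule ℚ (PolyXY n)} (hV : IsBigraded V) :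
    IsBigraded (V.map (flip ν hν)) := by
  rintro _ ⟨v, hv, rfl⟩ d
  rw [component_flip]
  split_ifs
  · exact Submodule.mem_map_of_mem (hV v hv _)
  · exact zero_mem _

theorem isInvariant_map_flip {V : Submodule ℚ (PolyXY n)} (hV : IsInvariant V) :
    IsInvariant (V.map (flip ν hν)) := by
  rintro σ _ ⟨v, hv, rfl⟩
  refine ⟨((Equiv.Perm.sign σ : ℤ) : ℚ) • diagAct σ v, Submodule.smul_mem _ _ (hV σ v hv), ?_⟩
  rw [map_smul, flip_diagAct, smul_smul, sign_mul_self, one_smul]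

theorem map_flip_inf_bihom {V : Submodule ℚ (PolyXY n)} (hV : IsBigraded V) (d : ℕ × ℕ) :
    V.map (flip ν hν) ⊓ bihom n d =
      if d ≤ deltaDegree ν then (V ⊓ bihom n (deltaDegree ν - d)).map (flip ν hν) else ⊥ := by
  ext w
  constructor
  · rintro ⟨⟨v, hv, rfl⟩, hd⟩
    have h := component_of_mem (d := d) hd
    rw [if_pos rfl, component_flip] at h
    rw [← h]
    split_ifs
    · exact Submodule.mem_map_of_mem ⟨hV v hv _, component_mem _ v⟩
    · exact zero_mem _
  · split_ifs with hle
    · rintro ⟨v, ⟨hv, hd⟩, rfl⟩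
      refine ⟨Submodule.mem_map_of_mem hv, ?_⟩
      have h := component_flip ν hν d v
      rw [if_pos hle, component_of_mem hd, if_pos rfl] at h
      rw [← h]
      exact component_mem d _
    · rintro rfl
      exact zero_mem _

/-- An operator whose degree is not bounded by $\deg\Delta_\nu$ annihilates $\Delta_\nu$, and the
flip is injective on $\mathbf M_\nu$. -/
theorem inf_bihom_eq_bot {V : Submodule ℚ (PolyXY n)} (hVM : V ≤ GHModule ν hν) {d : ℕ × ℕ}
    (hd : ¬ d ≤ deltaDegree ν) : V ⊓ bihom n d = ⊥ := by
  rw [eq_bot_iff]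
  rintro v ⟨hv, hvd⟩
  refine eq_zero_of_flip_eq_zero ν hν (hVM hv) ?_
  ext m
  by_contra hm
  have := weight_add_of_coeff_applyD_ne_zero (isWeightedHomogeneous_Delta ν hν) hvd hm
  exact hd (this ▸ le_add_self)

theorem traceOn_map_flip {V : Submodule ℚ (PolyXY n)} (hVM : V ≤ GHModule ν hν)
    (hV : IsInvariant V) (d : ℕ × ℕ) (σ : Equiv.Perm (Fin n)) :
    traceOn (diagAct σ) ((V ⊓ bihom n d).map (flip ν hν)) =
      ((Equiv.Perm.sign σ : ℤ) : ℚ) * traceOn (diagAct σ) (V ⊓ bihom n d) := by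
  rw [traceOn_eq _ (hV.inf_bihom d σ), traceOn_range ((diagAct σ).restrict (hV.inf_bihom d σ))
    (flip ν hν ∘ₗ (V ⊓ bihom n d).subtype) ?_ (diagAct σ) _ ?_ ?_]
  · rw [injective_iff_map_eq_zero]
    intro x hx
    ext1
    exact eq_zero_of_flip_eq_zero ν hν (hVM x.2.1) hx
  · intro x
    change diagAct σ (flip ν hν x) = _ • flip ν hν (diagAct σ x)
    rw [flip_diagAct, smul_smul, sign_mul_self, one_smul]
  · rw [LinearMap.range_comp, Submodule.range_subtype]

theorem bigradedChar_map_flip {V : Submodule ℚ (PolyXY n)} (hVM : V ≤ GHModule ν hν)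
    (hV : IsBigraded V) (hV' : IsInvariant V) (σ : Equiv.Perm (Fin n)) :
    bigradedChar (V.map (flip ν hν)) σ =
      Tmon ν * (algebraMap ℚ Qqt ((Equiv.Perm.sign σ : ℤ) : ℚ) * dualChar V σ) := by
  have h1 : bigradedChar (V.map (flip ν hν)) σ = ∑ d ∈ Finset.Iic (deltaDegree ν),
      tvar ^ d.1 * qvar ^ d.2 *
        algebraMap ℚ Qqt (traceOn (diagAct σ) (V.map (flip ν hν) ⊓ bihom n d)) := by
    refine finsum_eq_sum_of_support_subset _ fun d hd => ?_
    rw [Finset.mem_coe, Finset.mem_Iic]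
    by_contra hle
    apply hd
    simp only [map_flip_inf_bihom ν hν hV, if_neg hle, traceOn_bot, map_zero, mul_zero]
  have h2 : dualChar V σ = ∑ d ∈ Finset.Iic (deltaDegree ν), (tvar ^ d.1 * qvar ^ d.2)⁻¹ *
      algebraMap ℚ Qqt (traceOn (diagAct σ) (V ⊓ bihom n d)) := by
    refine finsum_eq_sum_of_support_subset _ fun d hd => ?_
    rw [Finset.mem_coe, Finset.mem_Iic]
    by_contra hle
    apply hd
    simp only [inf_bihom_eq_bot ν hν hVM hle, traceOn_bot, map_zero, mul_zero]
  rw [h1, h2, Finset.mul_sum, Finset.mul_sum]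
  -- Both sums now run over the box below $\deg\Delta_\nu$, on which $d\mapsto\deg\Delta_\nu-d$ is
  -- an involution.
  refine Finset.sum_nbij' (fun d => deltaDegree ν - d) (fun d => deltaDegree ν - d) ?_ ?_ ?_ ?_ ?_
  · exact fun d _ => Finset.mem_Iic.2 tsub_le_self
  · exact fun d _ => Finset.mem_Iic.2 tsub_le_self
  · exact fun d hd => tsub_tsub_cancel_of_le (Finset.mem_Iic.1 hd)
  · exact fun d hd => tsub_tsub_cancel_of_le (Finset.mem_Iic.1 hd)
  · intro d hd
    have hle := Finset.mem_Iic.1 hd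
    have hT : Tmon ν * (tvar ^ (deltaDegree ν - d).1 * qvar ^ (deltaDegree ν - d).2)⁻¹ =
        tvar ^ d.1 * qvar ^ d.2 := by
      have ht := tvar_ne_zero
      have hq := qvar_ne_zero
      rw [mul_inv_eq_iff_eq_mul₀ (mul_ne_zero (pow_ne_zero _ ht) (pow_ne_zero _ hq)), Tmon_eq,
        mul_mul_mul_comm, ← pow_add, ← pow_add, ← Prod.fst_add, ← Prod.snd_add,
        add_tsub_cancel_of_le hle]
    rw [map_flip_inf_bihom ν hν hV, if_pos hle, traceOn_map_flip ν hν hVM hV', map_mul, ← hT]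
    ring

/-- Only the scalar on the right involves $\nu$; this makes flips at different corners comparable.
-/
theorem frobenius_map_flip {V : Submodule ℚ (PolyXY n)} (hVM : V ≤ GHModule ν hν)
    (hV : IsBigraded V) (hV' : IsInvariant V) :
    frobenius (V.map (flip ν hν)) = Tmon ν • dualFrobenius V := by
  simp only [frobenius, dualFrobenius, bigradedChar_map_flip ν hν hVM hV hV']
  rw [smul_comm, Finset.smul_sum (r := Tmon ν)]
  simp only [smul_smul]

end

end Bigraded

/-! ## Inversion of the expansion in elementary symmetric functions -/

section Inversion

variable {ι K V : Type*} [Fintype ι] [DecidableEq ι] [Field K] [AddCommGroup V] [Module K V]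
  (T : ι → K)

/-- The coefficient `∏_{s ≠ j} 1/(1 - T_j/T_s)`. -/
def lagrangeCoeff (j : ι) : K := ∏ s ∈ Finset.univ.erase j, (1 - T j / T s)⁻¹

/-- The `r`-th elementary symmetric function of the `1/T_j` for `j ≠ c`. -/
def esymmInv (c : ι) (r : ℕ) : K :=
  ∑ U ∈ (Finset.univ.erase c).powersetCard r, ∏ i ∈ U, (T i)⁻¹

/-- For $j=c$ the factors cancel in pairs; for $j\ne c$ the factor with $i=j$ is zero. -/
theorem lagrangeCoeff_mul_prod (hT : Function.Injective T) (h0 : ∀ i, T i ≠ 0) (c j : ι) :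
    lagrangeCoeff T j * ∏ i ∈ Finset.univ.erase c, (1 - T j / T i) = if j = c then 1 else 0 := by
  split_ifs with h
  · subst h
    rw [lagrangeCoeff, ← Finset.prod_mul_distrib]
    refine Finset.prod_eq_one fun s hs => inv_mul_cancel₀ ?_
    rw [sub_ne_zero, ne_comm, Ne, div_eq_one_iff_eq (h0 s), hT.eq_iff]
    exact (Finset.ne_of_mem_erase hs).symm
  · rw [Finset.prod_eq_zero (Finset.mem_erase.2 ⟨h, Finset.mem_univ j⟩), mul_zero]
    rw [div_self (h0 j), sub_self]

theorem prod_one_sub_div {ι K : Type*} [Field K] (T : ι → K) (s : Finset ι) (z : K) :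
    ∏ i ∈ s, (1 - z / T i) = ∑ U ∈ s.powerset, (∏ i ∈ U, T i)⁻¹ * (-z) ^ U.card := by
  have h : ∀ i ∈ s, 1 - z / T i = 1 + (T i)⁻¹ * (-z) := fun i _ => by ring
  rw [Finset.prod_congr rfl h, Finset.prod_one_add]
  refine Finset.sum_congr rfl fun U _ => ?_
  rw [Finset.prod_mul_distrib, Finset.prod_const, Finset.prod_inv_distrib]

/-- Subsets are grouped by size, with $k=m-|U|$; omitting $c$ forces $|U|<m$, so $k$ starts at 1. -/
theorem sum_powerset_erase_smul (c : ι) (f : ℕ → V) :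
    ∑ U ∈ (Finset.univ.erase c).powerset, (∏ i ∈ U, T i)⁻¹ • f (Fintype.card ι - U.card) =
      ∑ k ∈ Finset.Icc 1 (Fintype.card ι), esymmInv T c (Fintype.card ι - k) • f k := by
  have hpos : 0 < Fintype.card ι := Fintype.card_pos_iff.2 ⟨c⟩
  have hcard : (Finset.univ.erase c).card = Fintype.card ι - 1 := by
    rw [Finset.card_erase_of_mem (Finset.mem_univ c), Finset.card_univ]
  rw [Finset.sum_powerset, hcard, Nat.sub_add_cancel hpos]
  refine Finset.sum_nbij' (fun j => Fintype.card ι - j) (fun k => Fintype.card ι - k) ?_ ?_ ?_ ?_ ?_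
  · intro j hj
    rw [Finset.mem_range] at hj
    exact Finset.mem_Icc.2 ⟨by omega, by omega⟩
  · intro k hk
    rw [Finset.mem_Icc] at hk
    exact Finset.mem_range.2 (by omega)
  · intro j hj
    rw [Finset.mem_range] at hj
    omega
  · intro k hk
    rw [Finset.mem_Icc] at hk
    omega
  · intro j hj
    rw [Finset.mem_range] at hj
    rw [Nat.sub_sub_self hj.le, esymmInv, Finset.sum_smul]
    refine Finset.sum_congr rfl fun U hU => ?_
    rw [(Finset.mem_powersetCard.1 hU).2, Finset.prod_inv_distrib]

theorem sum_Icc_one_eq_sum_fin {W : Type*} [AddCommMonoid W] (m : ℕ) (g : ℕ → W) :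
    ∑ k ∈ Finset.Icc 1 m, g k = ∑ k : Fin m, g (k + 1) := by
  rw [Fin.sum_univ_eq_sum_range (fun k => g (k + 1)), Finset.range_eq_Ico,
    Finset.sum_Ico_add' g 0 m 1]
  rfl

variable {T}

theorem eq_sum_lagrangeCoeff_smul (hT : Function.Injective T) (h0 : ∀ i, T i ≠ 0) {H : ι → V}
    {Φ : ℕ → V}
    (hH : ∀ c, H c = ∑ k ∈ Finset.Icc 1 (Fintype.card ι), esymmInv T c (Fintype.card ι - k) • Φ k)
    {k : ℕ} (hk : k ∈ Finset.Icc 1 (Fintype.card ι)) :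
    Φ k = ∑ j, (lagrangeCoeff T j * (-T j) ^ (Fintype.card ι - k)) • H j := by
  set m := Fintype.card ι with hm
  let E : Matrix ι (Fin m) K := Matrix.of fun c k => esymmInv T c (m - (k + 1))
  let W : Matrix (Fin m) ι K :=
    Matrix.of fun k j => lagrangeCoeff T j * (-T j) ^ (m - ((k : ℕ) + 1))
  -- The entry at $(c,j)$ is the Lagrange coefficient of $j$ times the expansion of $\prod_{i\ne
  -- c}(1-T_j/T_i)$.
  have hEW : E * W = 1 := by
    ext c j
    have h1 := sum_powerset_erase_smul (V := K) T c fun k => (-T j) ^ (m - k)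
    have h2 : ∀ U ∈ (Finset.univ.erase c).powerset,
        (∏ i ∈ U, T i)⁻¹ • (-T j) ^ (m - (m - U.card)) =
          (∏ i ∈ U, T i)⁻¹ * (-T j) ^ U.card := by
      intro U _
      rw [Nat.sub_sub_self (Finset.card_le_univ U), smul_eq_mul]
    rw [← hm, Finset.sum_congr rfl h2, ← prod_one_sub_div T, sum_Icc_one_eq_sum_fin] at h1
    have h3 := lagrangeCoeff_mul_prod T hT h0 c j
    rw [h1, Finset.mul_sum] at h3
    rw [Matrix.mul_apply, Matrix.one_apply]
    simp only [E, W, Matrix.of_apply]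
    rw [show (if c = j then (1 : K) else 0) = if j = c then 1 else 0 by simp only [eq_comm], ← h3]
    refine Finset.sum_congr rfl fun k _ => ?_
    rw [smul_eq_mul]
    ring
  -- Both index types have $m$ elements, so a one-sided inverse is two-sided.
  have hWE : W * E = 1 :=
    (Matrix.mul_eq_one_comm_of_card_eq _ _ _ (by rw [Fintype.card_fin])).1 hEW
  obtain ⟨h1, h2⟩ := Finset.mem_Icc.1 hk
  obtain ⟨k, rfl⟩ : ∃ k', k = k' + 1 := ⟨k - 1, by omega⟩
  let k' : Fin m := ⟨k, by omega⟩
  have h3 : ∀ j, H j = ∑ l : Fin m, E j l • Φ (l + 1) := by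
    intro j
    rw [hH j, sum_Icc_one_eq_sum_fin]
    rfl
  calc Φ (k + 1) = ∑ l : Fin m, (W * E) k' l • Φ (l + 1) := by
        rw [hWE, Finset.sum_eq_single k']
        · rw [Matrix.one_apply_eq, one_smul]
        · intro l _ hl
          rw [Matrix.one_apply_ne hl.symm, zero_smul]
        · exact fun h => absurd (Finset.mem_univ _) h
    _ = ∑ j, W k' j • H j := by
        simp only [h3, Finset.smul_sum, smul_smul, Matrix.mul_apply, Finset.sum_smul]
        rw [Finset.sum_comm]

end Inversion

/-! ## Elementary symmetric functions of a finite alphabet -/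

/-- Both sides satisfy Newton's identities with the same power sums. Only positive indices of $E$
enter. -/
theorem plethysmEval_elementary {ι K : Type*} [Field K] [CharZero K] (s : Finset ι) (x : ι → K)
    (E : ℕ → K) (hE : ∀ r, E (r + 1) = ∑ i ∈ s, x i ^ (r + 1)) (r : ℕ) :
    plethysmEval E (elementary K r) = ∑ U ∈ s.powersetCard r, ∏ i ∈ U, x i := by
  classical
  have hes : ∀ r, aeval (fun i : s => x i) (esymm s K r) =
      ∑ U ∈ s.powersetCard r, ∏ i ∈ U, x i := by
    intro r
    rw [aeval_esymm_eq_multiset_esymm, ← Finset.esymm_map_val]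
    congr 1
    exact Multiset.attach_map_val' s.val x
  have hps : ∀ r, aeval (fun i : s => x i) (psum s K (r + 1)) = E (r + 1) := by
    intro r
    rw [hE, psum, map_sum, ← Finset.sum_coe_sort s]
    simp
  have hE' : ∀ r, plethysmEval E (powerSum K (r + 1)) = E (r + 1) := by
    intro r
    rw [plethysmEval, powerSum, aeval_X]
    rfl
  rw [← hes]
  induction r using Nat.strong_induction_on with
  | _ r ih =>
    cases r with
    | zero => rw [elementary, esymm_zero, map_one, map_one]
    | succ r =>
      have h0 : ((r : K) + 1) ≠ 0 := by exact_mod_cast r.succ_ne_zero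
      rw [elementary, map_mul, ← algebraMap_eq, AlgHom.commutes, Algebra.algebraMap_self_apply,
        inv_mul_eq_iff_eq_mul₀ h0]
      have hN := congrArg (aeval (fun i : s => x i)) (mul_esymm_eq_sum s K (r + 1))
      rw [map_mul, map_natCast, map_mul, map_sum] at hN
      push_cast at hN
      rw [hN, map_sum, Finset.mul_sum,
        Fin.sum_univ_eq_sum_range (fun i => plethysmEval E ((-1) ^ i * powerSum K (i + 1) *
          elementary K (r - i)))]
      refine Finset.sum_nbij' (fun i => (r - i, i + 1)) (fun a => a.2 - 1) ?_ ?_ ?_ ?_ ?_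
      · intro i hi
        rw [Finset.mem_range] at hi
        rw [Finset.mem_filter, Finset.HasAntidiagonal.mem_antidiagonal]
        omega
      · intro a ha
        simp only [Finset.mem_filter, Finset.HasAntidiagonal.mem_antidiagonal] at ha
        rw [Finset.mem_range]
        omega
      · intro i _
        rfl
      · intro a ha
        simp only [Finset.mem_filter, Finset.HasAntidiagonal.mem_antidiagonal] at ha
        ext <;> simp only <;> omega
      · intro i hi
        rw [Finset.mem_range] at hi
        simp only [map_mul, map_pow, map_neg, map_one, hE', hps]
        rw [ih _ (by omega)]
        have hs : (-1 : K) ^ (r + 1 + 1) * (-1) ^ (r - i) = (-1) ^ i := by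
          rw [← pow_add, show r + 1 + 1 + (r - i) = 2 * (r - i + 1) + i by omega, pow_add, pow_mul]
          simp
        rw [← mul_assoc, ← mul_assoc, hs]
        ring

/-! ## The predecessors of a partition -/

section Predecessors

variable {μ : YoungDiagram}

theorem Tmon_ne_zero (ν : YoungDiagram) : Tmon ν ≠ 0 :=
  Finset.prod_ne_zero_iff.2 fun _ _ =>
    mul_ne_zero (pow_ne_zero _ tvar_ne_zero) (pow_ne_zero _ qvar_ne_zero)

theorem Tc_ne_zero (c : Corner μ) : Tc c ≠ 0 := Tmon_ne_zero _

theorem Tc_mul (c : Corner μ) : Tc c * (tvar ^ c.1.1 * qvar ^ c.1.2) = Tmon μ :=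
  Finset.prod_erase_mul _ _ (Finset.mem_filter.1 c.2).1

/-- The quotient $T_\mu/T_c$ is the monomial of the removed cell, which determines $c$. -/
theorem Tc_injective : Function.Injective (Tc : Corner μ → Qqt) := by
  intro c c' h
  have h1 := (Tc_mul c).trans (Tc_mul c').symm
  rw [h] at h1
  obtain ⟨h2, h3⟩ := monomial_qt_injective (mul_left_cancel₀ (Tmon_ne_zero _) h1)
  exact Subtype.ext (Prod.ext h2 h3)

theorem linearIndependent_Hc : LinearIndependent Qqt (Hc : Corner μ → SymFun Qqt) :=
  linearIndependent_Htilde.comp (pred μ) fun _ _ h => Tc_injective (congrArg Tmon h)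

theorem nabla_Hc (c : Corner μ) : nabla (Hc c) = Tc c • Hc c := nabla_Htilde _

theorem PhiMu_eq : PhiMu μ = ∑ j : Corner μ, lagrangeCoeff Tc j • Hc j := rfl

/-- A polynomial in $\nabla$ acts on the eigenvector $\widetilde H_{\alpha^{(j)}}$ by its value at
$T_j$; identities for $\nabla$ thus become scalar ones. -/
theorem aeval_nabla_PhiMu (p : Polynomial Qqt) :
    Polynomial.aeval nabla p (PhiMu μ) =
      ∑ j : Corner μ, (lagrangeCoeff Tc j * p.eval (Tc j)) • Hc j := by
  rw [PhiMu_eq, map_sum]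
  refine Finset.sum_congr rfl fun j _ => ?_
  have h : Module.End.HasEigenvector nabla (Tc j) (Hc j) :=
    Module.End.hasEigenvector_iff.2 ⟨Module.End.mem_eigenspace_iff.2 (nabla_Hc j),
      linearIndependent_Hc.ne_zero j⟩
  rw [map_smul, Module.End.aeval_apply_of_hasEigenvector h, smul_smul]

theorem neg_nabla_pow_PhiMu (r : ℕ) :
    ((-nabla) ^ r) (PhiMu μ) = ∑ j : Corner μ, (lagrangeCoeff Tc j * (-Tc j) ^ r) • Hc j := by
  have h := aeval_nabla_PhiMu (μ := μ) ((-Polynomial.X) ^ r)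
  simpa using h

theorem nablaProd_PhiMu (S : Finset (Corner μ)) :
    nablaProd S (PhiMu μ) =
      ∑ j : Corner μ, (lagrangeCoeff Tc j * ∏ i ∈ S, (1 - Tc j / Tc i)) • Hc j := by
  rw [nablaProd, aeval_nabla_PhiMu]
  refine Finset.sum_congr rfl fun j _ => ?_
  rw [Polynomial.eval_prod]
  congr 2
  refine Finset.prod_congr rfl fun i _ => ?_
  simp [div_eq_inv_mul]

theorem Hc_eq_nablaProd_PhiMu (c : Corner μ) :
    Hc c = nablaProd (Finset.univ.erase c) (PhiMu μ) := by
  rw [nablaProd_PhiMu]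
  simp only [lagrangeCoeff_mul_prod Tc Tc_injective Tc_ne_zero c]
  simp

end Predecessors

/-! ## Consequences of the Science Fiction heuristic -/

/-- A function on nonempty finite sets that is unchanged when one element is exchanged depends only
on the cardinality. -/
theorem eq_of_card_eq_of_exchange {ι V : Type*} [DecidableEq ι] {f : Finset ι → V}
    (h : ∀ (R : Finset ι) (c c' : ι), c ∉ R → c' ∉ R → f (insert c R) = f (insert c' R))
    {S S' : Finset ι} (hcard : S.card = S'.card) : f S = f S' := by
  induction hn : (S \ S').card generalizing S with
  | zero =>
    rw [Finset.card_eq_zero, Finset.sdiff_eq_empty_iff_subset] at hn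
    rw [Finset.eq_of_subset_of_card_le hn hcard.ge]
  | succ k ih =>
    have hn' : (S' \ S).card = k + 1 := by
      rw [← hn]
      exact Finset.card_sdiff_comm hcard.symm
    obtain ⟨a, ha⟩ := Finset.card_pos.1 (by omega : 0 < (S \ S').card)
    obtain ⟨b, hb⟩ := Finset.card_pos.1 (by omega : 0 < (S' \ S).card)
    rw [Finset.mem_sdiff] at ha hb
    have hb' : b ∉ S.erase a := fun hb' => hb.2 (Finset.mem_of_mem_erase hb')
    -- Trading $a\in S\setminus S'$ for $b\in S'\setminus S$ shrinks the difference by one.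
    have h1 := h (S.erase a) a b (Finset.notMem_erase a S) hb'
    rw [Finset.insert_erase ha.1] at h1
    rw [h1]
    apply ih
    · rw [Finset.card_insert_of_notMem hb', Finset.card_erase_add_one ha.1, hcard]
    · have h2 : insert b (S.erase a) \ S' = (S \ S').erase a := by
        rw [Finset.insert_sdiff_of_mem _ hb.1, Finset.erase_sdiff_comm]
      rw [h2, Finset.card_erase_of_mem (Finset.mem_sdiff.2 ha), hn, Nat.add_sub_cancel]

section Heuristic

variable {n : ℕ} {μ : YoungDiagram} {hμ : μ.card = n + 1} {B : Set (PolyXY n)}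
  {Bc : Corner μ → Set (PolyXY n)}

namespace IsSFBasis

theorem isBigraded_wordModule (hSF : IsSFBasis hμ B Bc) (S : Finset (Corner μ)) :
    IsBigraded (wordModule B Bc S) :=
  isBigraded_span fun b hb => hSF.bihomogeneous b hb.1

theorem finiteDimensional_of_le (hSF : IsSFBasis hμ B Bc) {V : Submodule ℚ (PolyXY n)}
    (hV : V ≤ Submodule.span ℚ B) : FiniteDimensional ℚ V := by
  have h : ∀ c, FiniteDimensional ℚ (Mc hμ c) := fun c => finiteDimensional_GHModule _ _
  rw [hSF.span_eq] at hV
  exact Submodule.finiteDimensional_of_le hV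

theorem wordModule_le_span (S : Finset (Corner μ)) :
    wordModule B Bc S ≤ Submodule.span ℚ B := Submodule.span_mono fun _ hb => hb.1

theorem sup_wordModule (F : Finset (Finset (Corner μ))) : F.sup (wordModule B Bc) =
    Submodule.span ℚ {b | b ∈ B ∧ ∃ S ∈ F, ∀ c, b ∈ Bc c ↔ c ∈ S} := by
  rw [Finset.sup_eq_iSup]
  simp only [wordModule, ← Submodule.span_iUnion]
  congr 1
  ext b
  simp only [Set.mem_iUnion, Set.mem_ofPred_eq]
  grind

theorem frobenius_sup_wordModule (hSF : IsSFBasis hμ B Bc) (F : Finset (Finset (Corner μ))) :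
    frobenius (F.sup (wordModule B Bc)) = ∑ S ∈ F, frobenius (wordModule B Bc S) := by
  -- Gradedness and invariance are carried through the induction because additivity of `frobenius`
  -- requires them.
  have key : IsBigraded (F.sup (wordModule B Bc)) ∧ IsInvariant (F.sup (wordModule B Bc)) ∧
      frobenius (F.sup (wordModule B Bc)) = ∑ S ∈ F, frobenius (wordModule B Bc S) := by
    induction F using Finset.induction_on with
    | empty =>
      refine ⟨?_, ?_, ?_⟩
      · rintro v hv d
        rw [Finset.sup_empty, Submodule.mem_bot] at hv
        rw [hv, map_zero]
        exact zero_mem _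
      · rintro σ v hv
        rw [Finset.sup_empty, Submodule.mem_bot] at hv
        rw [hv, map_zero]
        exact zero_mem _
      · rw [Finset.sup_empty, Finset.sum_empty, frobenius_bot]
    | insert S F hS ih =>
      obtain ⟨h1, h2, h3⟩ := ih
      have hB := hSF.isBigraded_wordModule S
      have hI : IsInvariant (wordModule B Bc S) := hSF.invariant S
      have : FiniteDimensional ℚ (wordModule B Bc S) :=
        hSF.finiteDimensional_of_le (wordModule_le_span S)
      have : FiniteDimensional ℚ (F.sup (wordModule B Bc) : Submodule ℚ (PolyXY n)) :=
        hSF.finiteDimensional_of_le (Finset.sup_le fun S _ => wordModule_le_span S)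
      have hdisj : Disjoint (wordModule B Bc S) (F.sup (wordModule B Bc)) := by
        rw [sup_wordModule]
        -- Different words use disjoint parts of the basis, whose spans meet trivially.
        refine ((linearIndepOn_id_union_iff ?_).1 (hSF.linearIndependent.mono
          (Set.union_subset (fun b hb => hb.1) fun b hb => hb.1))).2.2
        rw [Set.disjoint_left]
        rintro b ⟨-, hb⟩ ⟨-, S', hS', hb'⟩
        refine hS ?_
        have : S = S' := by
          ext c
          rw [← hb, hb']
        rwa [this]
      rw [Finset.sup_insert, Finset.sum_insert hS]
      exact ⟨hB.sup h1, hI.sup h2, by rw [frobenius_sup hdisj hB h1 hI h2, h3]⟩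
  exact key.2.2

theorem iInf_Mc_eq_sup (hSF : IsSFBasis hμ B Bc) {S : Finset (Corner μ)} (hS : S.Nonempty) :
    ⨅ c ∈ S, Mc hμ c = (Finset.univ.filter (S ⊆ ·)).sup (wordModule B Bc) := by
  classical
  rw [sup_wordModule]
  apply le_antisymm
  · let b := Module.Basis.extend hSF.linearIndependent
    have hsub := hSF.linearIndependent.subset_extend (Set.subset_univ B)
    have himage : ∀ A : Set (PolyXY n), A ⊆ B → b '' (Subtype.val ⁻¹' A) = A := by
      intro A hA
      rw [Module.Basis.coe_extend, Subtype.image_preimage_coe, Set.inter_eq_right]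
      exact hA.trans hsub
    intro x hx
    rw [Submodule.mem_iInf] at hx
    have hx' : ∀ c ∈ S, ((b.repr x).support :
        Set (hSF.linearIndependent.extend (Set.subset_univ B))) ⊆ Subtype.val ⁻¹' (Bc c) := by
      intro c hc
      rw [← b.mem_span_image, himage _ (hSF.subset c), hSF.span_subset]
      exact (Submodule.mem_iInf _).1 (hx c) hc
    obtain ⟨c₀, hc₀⟩ := hS
    have h1 : x ∈ Submodule.span ℚ {a | a ∈ B ∧ ∀ c ∈ S, a ∈ Bc c} := by
      rw [← himage {a | a ∈ B ∧ ∀ c ∈ S, a ∈ Bc c} (fun a ha => ha.1), b.mem_span_image]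
      intro a ha
      exact ⟨hSF.subset c₀ (hx' c₀ hc₀ ha), fun c hc => hx' c hc ha⟩
    refine Submodule.span_mono ?_ h1
    rintro a ⟨ha, haS⟩
    refine ⟨ha, Finset.univ.filter (fun c => a ∈ Bc c), ?_, fun c => by simp⟩
    rw [Finset.mem_filter]
    exact ⟨Finset.mem_univ _, fun c hc => Finset.mem_filter.2 ⟨Finset.mem_univ _, haS c hc⟩⟩
  · refine le_iInf₂ fun c hc => ?_
    rw [← hSF.span_subset]
    refine Submodule.span_mono ?_
    rintro a ⟨-, S', hS', ha⟩
    exact (ha c).2 ((Finset.mem_filter.1 hS').2 hc)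

theorem frobenius_iInf_Mc (hSF : IsSFBasis hμ B Bc) {S : Finset (Corner μ)} (hS : S.Nonempty) :
    frobenius (⨅ c ∈ S, Mc hμ c) = ∑ U ∈ Sᶜ.powerset, frobenius (wordModule B Bc Uᶜ) := by
  rw [hSF.iInf_Mc_eq_sup hS, hSF.frobenius_sup_wordModule]
  refine Finset.sum_nbij' (fun R => Rᶜ) (fun U => Uᶜ) ?_ ?_ ?_ ?_ ?_
  · intro R hR
    exact Finset.mem_powerset.2 (Finset.compl_subset_compl.2 (Finset.mem_filter.1 hR).2)
  · intro U hU
    exact Finset.mem_filter.2 ⟨Finset.mem_univ _,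
      Finset.subset_compl_comm.1 (Finset.mem_powerset.1 hU)⟩
  · exact fun R _ => compl_compl R
  · exact fun U _ => compl_compl U
  · exact fun R _ => by rw [compl_compl]

/-- Postulate 3 identifies the left side with the characteristic of a flip, and $\mathbf M^{=S}$
lies in $\mathbf M_{\alpha^{(c)}}$ as $c\in S$. -/
theorem frobenius_wordModule_insert_compl (hSF : IsSFBasis hμ B Bc) {S : Finset (Corner μ)}
    {c : Corner μ} (hc : c ∈ S) :
    frobenius (wordModule B Bc (insert c Sᶜ)) = Tc c • dualFrobenius (wordModule B Bc S) := by
  have hle : wordModule B Bc S ≤ GHModule (pred μ c) (card_pred hμ c) := by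
    change _ ≤ Mc hμ c
    rw [← hSF.span_subset c]
    exact Submodule.span_mono fun b hb => (hb.2 c).2 hc
  have hB := hSF.isBigraded_wordModule S
  have hI : IsInvariant (wordModule B Bc S) := hSF.invariant S
  rw [← (hSF.flip_iso S c hc).frobenius_eq (isBigraded_map_flip _ _ hB)
    (isInvariant_map_flip _ _ hI), frobenius_map_flip _ _ hle hB hI]
  rfl

/-- `∏_{i ∉ S} T_i Φ^{=S}` depends only on the cardinality of `S`. -/
theorem prod_smul_frobenius_eq (hSF : IsSFBasis hμ B Bc) {S S' : Finset (Corner μ)}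
    (hcard : S.card = S'.card) :
    (∏ i ∈ Sᶜ, Tc i) • frobenius (wordModule B Bc S) =
      (∏ i ∈ S'ᶜ, Tc i) • frobenius (wordModule B Bc S') := by
  -- The factor $T_c$ produced by the flip completes the product over the complement of $R$; the
  -- right side no longer sees $c$.
  have key : ∀ (R : Finset (Corner μ)) (c : Corner μ), c ∉ R →
      (∏ i ∈ (insert c R)ᶜ, Tc i) • frobenius (wordModule B Bc (insert c R)) =
        (∏ i ∈ Rᶜ, Tc i) • dualFrobenius (wordModule B Bc Rᶜ) := by
    intro R c hc
    have hc' : c ∈ Rᶜ := Finset.mem_compl.2 hc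
    have h := hSF.frobenius_wordModule_insert_compl hc'
    rw [compl_compl] at h
    rw [h, smul_smul, Finset.compl_insert, Finset.prod_erase_mul _ _ hc']
  exact eq_of_card_eq_of_exchange
    (f := fun S => (∏ i ∈ Sᶜ, Tc i) • frobenius (wordModule B Bc S))
    (fun R c c' hc hc' => (key R c hc).trans (key R c' hc').symm) hcard

theorem exists_frobenius_wordModule_eq (hSF : IsSFBasis hμ B Bc) :
    ∃ Φ : ℕ → SymFun Qqt, ∀ S : Finset (Corner μ),
      frobenius (wordModule B Bc S) = (∏ i ∈ Sᶜ, Tc i)⁻¹ • Φ S.card := by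
  classical
  refine ⟨fun k => if h : ∃ S : Finset (Corner μ), S.card = k then
    (∏ i ∈ h.chooseᶜ, Tc i) • frobenius (wordModule B Bc h.choose) else 0, fun S => ?_⟩
  have h : ∃ S' : Finset (Corner μ), S'.card = S.card := ⟨S, rfl⟩
  simp only [dif_pos h]
  rw [hSF.prod_smul_frobenius_eq h.choose_spec, smul_smul,
    inv_mul_cancel₀ (Finset.prod_ne_zero_iff.2 fun i _ => Tc_ne_zero i), one_smul]

end IsSFBasis

end Heuristic

end ScienceFiction

end

/-! ### Assembly of the theorem. -/

open ScienceFiction in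
theorem theorem3p1 (n : ℕ) (μ : YoungDiagram) (hμ : μ.card = n + 1)
    (B : Set (PolyXY n)) (Bc : Corner μ → Set (PolyXY n))
    (hSF : IsSFBasis hμ B Bc)
    (hCH : ∀ c : Corner μ, frobenius (Mc hμ c) = Hc c) :
    ∃ Φ : ℕ → SymFun Qqt,
      (∀ S : Finset (Corner μ), S.Nonempty →
        frobenius (wordModule B Bc S) = (∏ i ∈ Sᶜ, Tc i)⁻¹ • Φ S.card) ∧
      (∀ k ∈ Finset.Icc 1 (corners μ).card,
        Φ k = ((-nabla) ^ ((corners μ).card - k)) (PhiMu μ)) ∧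
      (∀ S : Finset (Corner μ), S.Nonempty →
        frobenius (⨅ c ∈ S, Mc hμ c) = nablaProd Sᶜ (PhiMu μ)) ∧
      (∀ i : Corner μ, Hc i = nablaProd (Finset.univ.erase i) (PhiMu μ)) ∧
      (∀ i : Corner μ, Hc i = ∑ k ∈ Finset.Icc 1 (corners μ).card,
        plethysmEval (fun r => (∑ j : Corner μ, (Tc j)⁻¹ ^ r) - (Tc i)⁻¹ ^ r)
          (elementary Qqt ((corners μ).card - k)) • Φ k) ∧
      LinearIndependent Qqt (fun k : Fin (corners μ).card => Φ (k + 1)) ∧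
      Submodule.span Qqt (Set.range fun k : Fin (corners μ).card => Φ (k + 1)) =
        Submodule.span Qqt (Set.range fun i : Corner μ => Hc i) ∧
      (∀ k ∈ Finset.Icc 1 (corners μ).card,
        Φ k = ∑ j : Corner μ,
          ((∏ s ∈ Finset.univ.erase j, (1 - Tc j / Tc s)⁻¹) *
            (-Tc j) ^ ((corners μ).card - k)) • Hc j) := by
  have hm : (corners μ).card = Fintype.card (Corner μ) := (Fintype.card_coe _).symm
  obtain ⟨Φ, hΦ⟩ := hSF.exists_frobenius_wordModule_eq
  have hT := Tc_injective (μ := μ)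
  have hT0 := Tc_ne_zero (μ := μ)
  have hInf : ∀ S : Finset (Corner μ), S.Nonempty → frobenius (⨅ c ∈ S, Mc hμ c) =
      ∑ U ∈ Sᶜ.powerset, (∏ i ∈ U, Tc i)⁻¹ • Φ (Fintype.card (Corner μ) - U.card) := by
    intro S hS
    rw [hSF.frobenius_iInf_Mc hS]
    refine Finset.sum_congr rfl fun U _ => ?_
    rw [hΦ, compl_compl, Finset.card_compl]
  have hH : ∀ c : Corner μ, Hc c = ∑ k ∈ Finset.Icc 1 (Fintype.card (Corner μ)),
      esymmInv Tc c (Fintype.card (Corner μ) - k) • Φ k := by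
    intro c
    -- For a singleton the intersection is $\mathbf M_{\alpha^{(c)}}$, whose characteristic is known
    -- by assumption.
    have h := hInf {c} (Finset.singleton_nonempty c)
    have h1 : ⨅ c' ∈ ({c} : Finset (Corner μ)), Mc hμ c' = Mc hμ c := by simp
    rw [h1, hCH, Finset.compl_singleton, sum_powerset_erase_smul] at h
    exact h
  have hL : ∀ k ∈ Finset.Icc 1 (Fintype.card (Corner μ)), Φ k = ∑ j : Corner μ,
      (lagrangeCoeff Tc j * (-Tc j) ^ (Fintype.card (Corner μ) - k)) • Hc j :=
    fun k hk => eq_sum_lagrangeCoeff_smul hT hT0 hH hk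
  have hspan : Submodule.span Qqt (Set.range fun k : Fin (corners μ).card => Φ (k + 1)) =
      Submodule.span Qqt (Set.range fun i : Corner μ => Hc i) := by
    apply le_antisymm
    · rw [Submodule.span_le]
      rintro _ ⟨k, rfl⟩
      simp only
      rw [hL _ (Finset.mem_Icc.2 ⟨by omega, by omega⟩)]
      exact Submodule.sum_mem _ fun j _ => Submodule.smul_mem _ _ (Submodule.subset_span ⟨j, rfl⟩)
    · rw [Submodule.span_le]
      rintro _ ⟨c, rfl⟩
      simp only
      rw [hH c]
      refine Submodule.sum_mem _ fun k hk => Submodule.smul_mem _ _ (Submodule.subset_span ?_)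
      obtain ⟨h1, h2⟩ := Finset.mem_Icc.1 hk
      exact ⟨⟨k - 1, by omega⟩, by simp only [Nat.sub_add_cancel h1]⟩
  refine ⟨Φ, fun S _ => hΦ S, ?_, ?_, Hc_eq_nablaProd_PhiMu, ?_, ?_, hspan, ?_⟩
  · intro k hk
    rw [hm] at hk ⊢
    rw [neg_nabla_pow_PhiMu]
    exact hL k hk
  · intro S hS
    rw [hInf S hS, nablaProd_PhiMu]
    have h1 : ∀ U ∈ Sᶜ.powerset,
        (∏ i ∈ U, Tc i)⁻¹ • Φ (Fintype.card (Corner μ) - U.card) =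
        ∑ j : Corner μ, (lagrangeCoeff Tc j * ((∏ i ∈ U, Tc i)⁻¹ * (-Tc j) ^ U.card)) • Hc j := by
      intro U hU
      have h2 := Finset.card_le_card (Finset.mem_powerset.1 hU)
      rw [Finset.card_compl] at h2
      have h3 := Finset.card_pos.2 hS
      have h4 := Finset.card_le_univ S
      -- As $S$ is nonempty, $|U|\le m-|S|<m$, so the index $m-|U|$ is at least 1.
      rw [hL _ (Finset.mem_Icc.2 ⟨by omega, by omega⟩), Finset.smul_sum,
        Nat.sub_sub_self (Finset.card_le_univ U)]
      refine Finset.sum_congr rfl fun j _ => ?_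
      rw [smul_smul, mul_left_comm]
    rw [Finset.sum_congr rfl h1, Finset.sum_comm]
    refine Finset.sum_congr rfl fun j _ => ?_
    rw [← Finset.sum_smul, ← Finset.mul_sum, prod_one_sub_div]
  · intro c
    rw [hm]
    conv_lhs => rw [hH c]
    refine Finset.sum_congr rfl fun k _ => ?_
    rw [plethysmEval_elementary (Finset.univ.erase c) fun i => (Tc i)⁻¹]
    · rfl
    · intro r
      rw [sub_eq_iff_eq_add, Finset.sum_erase_add _ _ (Finset.mem_univ c)]
  -- The $m$ vectors span the same space as $m$ independent ones, hence are independent.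
  · rw [linearIndependent_iff_card_eq_finrank_span, Set.finrank, hspan,
      finrank_span_eq_card linearIndependent_Hc, Fintype.card_fin, hm]
  · intro k hk
    rw [hm] at hk ⊢
    exact hL k hk
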